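/- Let $k$ be a finite field and let $\pi\colon X\to Y$ be a Galois cover of projective nonsingular (irreducible) curves over $k$; that is, let $F=k(Y)$ be a function field in one variable over $k$ and $E=k(X)$ a finite Galois extension of $F$, with Galois group $H=\mathrm{Gal}(E/F)$. Let $\Omega_{F/k}$, $\Omega_{E/k}$ be the spaces of (meromorphic) differentials and $\pi^*\colon\Omega_{F/k}\to\Omega_{E/k}$, $a\,db\mapsto a\,db$, the pullback. For a place $P$ of $F$ (a discrete valuation ring $\mathcal O_P\supseteq k$ with fraction field $F$ and maximal ideal $\mathfrak m_P$) and a place $Q$ of $E$ over $P$, let $e(Q|P)$ be the ramification index and $\delta(Q|P)$ the exponent of $Q$ in the different of $E/F$. Let $\Omega_P\subset\Omega_{F/k}$ be the $\mathcal O_P$-module generated by $\{da : a\in\mathcal O_P\}$, and for $0\ne\omega\in\Omega_{F/k}$ let $\mathrm{ord}_P(\omega)$ be the largest integer $n$ with $\omega\in\mathfrak m_P^n\Omega_P$; likewise for places of $E$. Then: 1. $e(Q|P)$ and $\delta(Q|P)$ depend only on $P$; write $e_P$ and $\delta_P$ for them, and let $$\mathcal D=\prod_{P}P^{\lfloor \delta_P/e_P\rfloor},$$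 the product being over the places $P$ of $F$ (only those ramified in $E$ contribute). 2. Let $L_Y(\Omega_Y(\mathcal D))=\{\omega\in\Omega_{F/k} : \omega\in\mathfrak m_P^{-\lfloor\delta_P/e_P\rfloor}\Omega_P\text{ for all }P\}$, and let $H^0(X,\Omega_X)^H$ be the space of $H$-invariant holomorphic differentials on $X$ (those lying in $\Omega_Q$ for every place $Q$ of $E$ and fixed by all $\sigma\in H$, where $\sigma(a\,db)=\sigma(a)\,d\sigma(b)$). Then $\pi^*$ restricts to an isomorphism of $k$-vector spaces $$L_Y(\Omega_Y(\mathcal D))\;\xrightarrow{\ \sim\ }\;H^0(X,\Omega_X)^H .$$ 3. Let $f\in F$ with $df\neq0$ in $\Omega_{F/k}$ and put $$L_f=\{0\}\cup\Big\{g\in F^\times : \mathrm{ord}_P(g)+\mathrm{ord}_P(df)+\lfloor\delta_P/e_P\rfloor\ge 0\ \text{for all places } P \text{ of } F\Big\},$$ i.e. the space of the functions $g$ for which $\mathrm{div}_Y(g)\cdot\mathrm{div}_Y(df)\cdot\mathcal D$ is an integral divisor, together with $0$. Then $g\mapsto g\,df$ is an isomorphism of $k$-vector spaces $L_f\to L_Y(\Omega_Y(\mathcal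 D))$, and $g\mapsto \pi^*(g\,df)$ is an isomorphism of $k$-vector spaces $L_f\to H^0(X,\Omega_X)^H$. -/

import Mathlib

open scoped KaehlerDifferential WithZero

noncomputable section

/-- `F` is a function field in one variable over `k`, i.e. the function field of a complete
nonsingular (irreducible) curve over `k`: it is a finite extension of a rational function
field `k(t)`. -/
def IsCurveFunctionField (k F : Type*) [Field k] [Field F] [Algebra k F] : Prop :=
  ∃ t : F, Transcendental k t ∧ FiniteDimensional (IntermediateField.adjoin k {t}) F

/-- The map induced on differentials by a `k`-embedding of fields `φ : E → E'`, that is the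
`k`-linear map `a db ↦ φ(a) dφ(b)`. -/
def diffPullback {k E E' : Type*} [Field k] [Field E] [Field E'] [Algebra k E] [Algebra k E']
    (φ : E →ₐ[k] E') : Ω[E⁄k] →ₗ[k] Ω[E'⁄k] :=
  letI : Algebra E E' := φ.toRingHom.toAlgebra
  haveI : IsScalarTower k E E' := IsScalarTower.of_algHom φ
  (KaehlerDifferential.map k k E E').restrictScalars k

theorem diffPullback_smul_D {k E E' : Type*} [Field k] [Field E] [Field E'] [Algebra k E]
    [Algebra k E'] (φ : E →ₐ[k] E') (a b : E) :
    diffPullback φ (a • KaehlerDifferential.D k E b) =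
      φ a • KaehlerDifferential.D k E' (φ b) := by
  let : Algebra E E' := φ.toRingHom.toAlgebra
  have : IsScalarTower k E E' := IsScalarTower.of_algHom φ
  change KaehlerDifferential.map k k E E' (a • KaehlerDifferential.D k E b) = _
  rw [LinearMap.map_smul, KaehlerDifferential.map_D, algebra_compatible_smul E' a]
  rfl

/-- A place (prime divisor, closed point) of the curve with function field `F` over `k`: a
discrete valuation ring that contains `k` and has fraction field `F`. -/
structure Place (k F : Type*) [Field k] [Field F] [Algebra k F] where
  ring : ValuationSubring F
  algebraMap_mem : ∀ c : k, algebraMap k F c ∈ ring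
  isDVR : IsDiscreteValuationRing ring

namespace Place

section single

variable {k F : Type*} [Field k] [Field F] [Algebra k F]

instance (P : Place k F) : IsDiscreteValuationRing P.ring := P.isDVR

/-- The valuation of the place, with values in `ℤᵐ⁰`; a uniformizer has value `exp (-1)`. -/
def val (P : Place k F) : Valuation F ℤᵐ⁰ :=
  (IsDiscreteValuationRing.maximalIdeal P.ring).valuation F

/-- The normalized order `ord_P x ∈ ℤ` of `x ≠ 0` at the place `P` (junk value `0` at `x = 0`). -/
def ord (P : Place k F) (x : F) : ℤ := -WithZero.log (P.val x)

theorem le_ord_iff (P : Place k F) {x : F} (hx : x ≠ 0) (n : ℤ) :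
    n ≤ P.ord x ↔ P.val x ≤ WithZero.exp (-n) := by
  have h : P.val x ≠ 0 := (Valuation.ne_zero_iff _).2 hx
  rw [ord, ← WithZero.log_le_iff_le_exp h]
  omega

theorem val_algebraMap_le_one (P : Place k F) (c : k) : P.val (algebraMap k F c) ≤ 1 :=
  (IsDiscreteValuationRing.maximalIdeal P.ring).valuation_le_one
    (⟨algebraMap k F c, P.algebraMap_mem c⟩ : P.ring)

/-- The `k`-space `𝔪_P ^ n · Ω_P` inside the meromorphic differentials, where `Ω_P` is the
stalk at `P` of the sheaf of differentials: the module over the valuation ring `𝒪_P` that is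
generated by the differentials `da`, `a ∈ 𝒪_P`. -/
def diffLattice (P : Place k F) (n : ℤ) : Submodule k Ω[F⁄k] :=
  Submodule.span k {ω | ∃ x a : F, (x = 0 ∨ n ≤ P.ord x) ∧ a ∈ P.ring ∧
    ω = x • KaehlerDifferential.D k F a}

/-- The order at `P` of a differential `ω ≠ 0`: the largest `n` with `ω ∈ 𝔪_P ^ n · Ω_P`. -/
def ordDiff (P : Place k F) (ω : Ω[F⁄k]) : ℤ := sSup {n : ℤ | ω ∈ P.diffLattice n}

end single

section extension

variable {k F E : Type*} [Field k] [Field F] [Field E] [Algebra k F] [Algebra k E]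
  [Algebra F E]

/-- The place `Q` of `E` lies over the place `P` of `F`. -/
def LiesAbove (Q : Place k E) (P : Place k F) : Prop :=
  Q.ring.comap (algebraMap F E) = P.ring

/-- The integral closure in `E` of the valuation ring of `P`. -/
abbrev intClosure (E : Type*) [Field E] [Algebra F E] (P : Place k F) : Subalgebra P.ring E :=
  integralClosure P.ring E

instance (P : Place k F) [FiniteDimensional F E] [Algebra.IsSeparable F E] :
    IsDedekindDomain (P.intClosure E) :=
  integralClosure.isDedekindDomain P.ring F E

instance (P : Place k F) : Module.IsTorsionFree P.ring (P.intClosure E) := by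
  have : FaithfulSMul P.ring E := by
    rw [faithfulSMul_iff_algebraMap_injective]
    exact (algebraMap F E).injective.comp Subtype.val_injective
  infer_instance

theorem LiesAbove.intClosure_mem {Q : Place k E} {P : Place k F} (h : Q.LiesAbove P)
    (b : P.intClosure E) : (b : E) ∈ Q.ring := by
  obtain ⟨p, hp, hb⟩ := b.2
  let φ : P.ring →+* Q.ring :=
    ((algebraMap F E).comp P.ring.subtype).codRestrict Q.ring fun x => by
      have hx : (x : F) ∈ Q.ring.comap (algebraMap F E) := by rw [h]; exact x.2
      exact hx
  have hi : IsIntegral Q.ring (b : E) :=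
    ⟨p.map φ, hp.map φ, by rw [Polynomial.eval₂_map]; exact hb⟩
  obtain ⟨y, hy⟩ := IsIntegrallyClosed.isIntegral_iff.1 hi
  rw [← hy]
  exact y.2

/-- The prime ideal of the integral closure of `𝒪_P` in `E` that belongs to a place `Q` over `P`:
the elements that vanish at `Q`. -/
def LiesAbove.center {Q : Place k E} {P : Place k F} (h : Q.LiesAbove P) :
    Ideal (P.intClosure E) :=
  (IsLocalRing.maximalIdeal Q.ring).comap
    ((P.intClosure E).subtype.codRestrict Q.ring h.intClosure_mem)

/-- The ramification index `e(Q|P)`. -/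
def LiesAbove.ramIdx {Q : Place k E} {P : Place k F} (h : Q.LiesAbove P) : ℕ :=
  h.center.ramificationIdx P.ring

/-- The different exponent `δ(Q|P)`: the exponent of the prime ideal of `Q` in the different of
the integral closure of `𝒪_P` in `E` over `𝒪_P`. -/
def LiesAbove.diffExp [FiniteDimensional F E] [Algebra.IsSeparable F E]
    {Q : Place k E} {P : Place k F} (h : Q.LiesAbove P) : ℕ :=
  multiplicity h.center (differentIdeal P.ring (P.intClosure E))

open scoped Classical in
/-- The ramification index `e_P` of `P` in a Galois extension `E`: that of one, equivalently of
any, place of `E` over `P`. -/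
def ramIdxIn (E : Type*) [Field E] [Algebra k E] [Algebra F E] (P : Place k F) : ℕ :=
  if h : ∃ Q : Place k E, Q.LiesAbove P then h.choose_spec.ramIdx else 0

open scoped Classical in
/-- The different exponent `δ_P` of `P` in a Galois extension `E`: that of one, equivalently of
any, place of `E` over `P`. -/
def diffExpIn (E : Type*) [Field E] [Algebra k E] [Algebra F E] [FiniteDimensional F E]
    [Algebra.IsSeparable F E] (P : Place k F) : ℕ :=
  if h : ∃ Q : Place k E, Q.LiesAbove P then h.choose_spec.diffExp else 0

end extension

end Place

section spaces

/-- The differentials `L(Ω(D))` of the curve that are sections of `Ω(D)`, where the divisor `D` is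
given by its exponents `P ↦ D P`: at every place `P`, they lie in `𝔪_P ^ (-D P) · Ω_P`, so that
`D P` bounds the order of their pole. -/
def diffSpace {k F : Type*} [Field k] [Field F] [Algebra k F] (D : Place k F → ℤ) :
    Submodule k Ω[F⁄k] :=
  ⨅ P : Place k F, P.diffLattice (-D P)

/-- The holomorphic differentials `H⁰(X, Ω_X)` of the curve `X` with function field `E`. -/
def holDiff (k E : Type*) [Field k] [Field E] [Algebra k E] : Submodule k Ω[E⁄k] :=
  diffSpace (fun _ : Place k E => 0)

/-- The holomorphic differentials on `X` that are invariant under the Galois group of `E/F`. -/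
def invHolDiff (k F E : Type*) [Field k] [Field F] [Field E] [Algebra k F] [Algebra k E]
    [Algebra F E] [IsScalarTower k F E] : Submodule k Ω[E⁄k] :=
  holDiff k E ⊓ ⨅ σ : E ≃ₐ[F] E,
    LinearMap.eqLocus (diffPullback (σ.toAlgHom.restrictScalars k)) LinearMap.id

/-- The Riemann-Roch space of functions `g` for which `div(g) + D` is an integral (effective)
divisor, together with `g = 0`. The divisor `D` is given by its exponents `P ↦ D P`. -/
def rrSpace {k F : Type*} [Field k] [Field F] [Algebra k F] (D : Place k F → ℤ) :
    Submodule k F where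
  carrier := {g | g = 0 ∨ ∀ P : Place k F, 0 ≤ P.ord g + D P}
  zero_mem' := Or.inl rfl
  add_mem' {a b} ha hb := by
    by_cases ha0 : a = 0
    · simpa [ha0] using hb
    by_cases hb0 : b = 0
    · simpa [hb0] using ha
    by_cases hab : a + b = 0
    · exact Or.inl hab
    refine Or.inr fun P => ?_
    have h1 := (P.le_ord_iff ha0 (-D P)).1 (by have := ha.resolve_left ha0 P; omega)
    have h2 := (P.le_ord_iff hb0 (-D P)).1 (by have := hb.resolve_left hb0 P; omega)
    have h3 := (P.le_ord_iff hab (-D P)).2 (P.val.map_add_le h1 h2)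
    omega
  smul_mem' c g hg := by
    by_cases hc : c • g = 0
    · exact Or.inl hc
    have hg0 : g ≠ 0 := fun h => hc (by rw [h, smul_zero])
    refine Or.inr fun P => ?_
    have h1 := (P.le_ord_iff hg0 (-D P)).1 (by have := hg.resolve_left hg0 P; omega)
    have h3 := (P.le_ord_iff hc (-D P)).2 (by
      rw [Algebra.smul_def, map_mul]
      exact (mul_le_of_le_one_left' (P.val_algebraMap_le_one c)).trans h1)
    omega

/-- The divisor `∏ P_i ^ ⌊δ_i / e_i⌋` on `Y`, given by its exponents: `P ↦ ⌊δ_P / e_P⌋`. The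
exponent is `0` at the places `P` that are unramified in `E`. -/
def floorDifferent (k F E : Type*) [Field k] [Field F] [Field E] [Algebra k F] [Algebra k E]
    [Algebra F E] [FiniteDimensional F E] [Algebra.IsSeparable F E] : Place k F → ℤ :=
  fun P => ⌊(P.diffExpIn E : ℚ) / (P.ramIdxIn E : ℚ)⌋

end spaces

end

/-! ### p-bases: expansions in powers of one element over the p-th powers -/

section PBasis

open Module

/-! The heart is local. If t is a uniformizer at P, then Ω_P is free over 𝒪_P on dt. If s is a
uniformizer at Q over P and dt = u ds, then ord_Q(u) = δ(Q|P). Hence π^*(g dt) = g u ds has order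
e·ord_P(g) + δ at Q, and it is holomorphic there exactly when ord_P(g) ≥ -⌊δ/e⌋. Globally, Ω_{E/k} =
E df for any f in F with df ≠ 0, and H fixes df, so a df is invariant exactly when a lies in E^H =
F.

Freeness on dt comes from p-bases rather than completions. As k is perfect, [F : F^p] ≤ p, so every
element is a sum of c_i^p t^i with i < p (`IsCurveFunctionField.exists_eq_sum_pow`). The orders of
the nonzero terms are distinct mod p, so nothing cancels: an integral element has integral c_i, and
its derivative with respect to t is integral.

For the different, let A = 𝒪_P, let B be its integral closure in E and s a uniformizer at all primes
of B at once. The same expansion holds in B, giving dt = u ds with u in B, and the different is (u)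
(`Place.exists_differentIdeal_eq_span`). On one side, m in the different satisfies m·dB ⊆ B·dA = B·u
ds (`smul_derivation_mem_of_mem_differentIdeal`). On the other, u ds = 0 in Ω_{B/A}, so u lies in
the Noether different, which is contained in the Dedekind different
(`mem_differentIdeal_of_annihilator`). -/

theorem Subfield.relfinrank_frobenius {F : Type*} [Field F] (p : ℕ) [ExpChar F p]
    (K : Subfield F) (hK : FiniteDimensional K F) :
    Subfield.relfinrank (frobenius F p).fieldRange ⊤ =
      Subfield.relfinrank (K.map (frobenius F p)) K := by
  have hle : K.map (frobenius F p) ≤ K := by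
    rintro _ ⟨x, hx, rfl⟩
    exact pow_mem hx p
  have hle' : K.map (frobenius F p) ≤ (frobenius F p).fieldRange := by
    rintro _ ⟨x, -, rfl⟩
    exact ⟨x, rfl⟩
  -- Compute [F : K^p] through K and through F^p; Frobenius gives [F^p : K^p] = [F : K], which is
  -- finite and cancels.
  have h1 := Subfield.relfinrank_mul_relfinrank hle le_top
  have h2 := Subfield.relfinrank_mul_relfinrank hle' le_top
  have h3 : Subfield.relfinrank (K.map (frobenius F p)) (frobenius F p).fieldRange =
      Subfield.relfinrank K ⊤ := by
    rw [RingHom.fieldRange_eq_map, Subfield.relfinrank_map_map]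
  have h4 : Subfield.relfinrank K ⊤ ≠ 0 := by
    rw [Subfield.relfinrank_top_right]
    exact (finrank_pos (R := K) (M := F)).ne'
  rw [h3, ← h1, mul_comm] at h2
  exact Nat.eq_of_mul_eq_mul_right (Nat.pos_of_ne_zero h4) h2

/-- As k is perfect, K = k(s) equals K^p(s), and s is a root of X^p - s^p. Being nonzero records
that the degree is finite, since an infinite rank would count as 0. -/
theorem IntermediateField.relfinrank_frobenius_adjoin_simple {k F : Type*} [Field k] [Field F]
    [Algebra k F] (p : ℕ) [Fact p.Prime] [CharP k p] [CharP F p] [PerfectRing k p] (s : F) :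
    Subfield.relfinrank ((IntermediateField.adjoin k {s}).toSubfield.map (frobenius F p))
      (IntermediateField.adjoin k {s}).toSubfield ≤ p ∧
    Subfield.relfinrank ((IntermediateField.adjoin k {s}).toSubfield.map (frobenius F p))
      (IntermediateField.adjoin k {s}).toSubfield ≠ 0 := by
  set K := (IntermediateField.adjoin k {s}).toSubfield with hK
  set K' := K.map (frobenius F p) with hK'
  have hs : s ∈ K := IntermediateField.mem_adjoin_simple_self k s
  have hle : K' ≤ K := by
    rintro _ ⟨x, hx, rfl⟩
    exact pow_mem hx p
  have hsp : s ^ p ∈ K' := ⟨s, hs, rfl⟩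
  have heq : Subfield.extendScalars hle = IntermediateField.adjoin K' {s} := by
    apply le_antisymm
    · have hk : ∀ c : k, algebraMap k F c ∈ IntermediateField.adjoin K' {s} := by
        intro c
        obtain ⟨d, rfl⟩ := surjective_frobenius k p c
        have : algebraMap k F (frobenius k p d) ∈ K' :=
          ⟨algebraMap k F d, (IntermediateField.adjoin k {s}).algebraMap_mem d, by
            simp [frobenius_def]⟩
        exact (IntermediateField.adjoin K' {s}).algebraMap_mem ⟨_, this⟩
      let M : IntermediateField k F :=
        { (IntermediateField.adjoin K' {s}).toSubfield with algebraMap_mem' := hk }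
      have : IntermediateField.adjoin k {s} ≤ M := by
        rw [IntermediateField.adjoin_simple_le_iff]
        exact IntermediateField.mem_adjoin_simple_self K' s
      exact this
    · rw [IntermediateField.adjoin_simple_le_iff]
      exact hs
  let a : K' := ⟨s ^ p, hsp⟩
  have hroot : Polynomial.aeval s (Polynomial.X ^ p - Polynomial.C a) = 0 := by
    simp [a, Algebra.algebraMap_ofSubsemiring_apply]
  have hmonic : (Polynomial.X ^ p - Polynomial.C a).Monic :=
    Polynomial.monic_X_pow_sub_C a (Fact.out : p.Prime).ne_zero
  have hint : IsIntegral K' s := ⟨_, hmonic, hroot⟩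
  rw [Subfield.relfinrank_eq_finrank_of_le hle, heq, IntermediateField.adjoin.finrank hint]
  refine ⟨?_, (minpoly.natDegree_pos hint).ne'⟩
  have := Polynomial.natDegree_le_of_dvd (minpoly.dvd K' s hroot) hmonic.ne_zero
  rwa [Polynomial.natDegree_X_pow_sub_C] at this

/-- In a function field in one variable over a perfect field of characteristic `p`, every element
`f` that is not a `p`-th power is a `p`-basis. -/
theorem IsCurveFunctionField.exists_eq_sum_pow {k F : Type*} [Field k] [Field F] [Algebra k F]
    (hF : IsCurveFunctionField k F) (p : ℕ) [Fact p.Prime] [CharP k p] [CharP F p]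
    [PerfectRing k p] {f : F} (hf : ∀ b : F, b ^ p ≠ f) (a : F) :
    ∃ c : ℕ → F, a = ∑ i ∈ Finset.range p, c i ^ p * f ^ i := by
  obtain ⟨s, -, hfin⟩ := hF
  obtain ⟨hle, hne⟩ := IntermediateField.relfinrank_frobenius_adjoin_simple (k := k) p s
  rw [← Subfield.relfinrank_frobenius p (IntermediateField.adjoin k {s}).toSubfield hfin, Subfield.relfinrank_top_right] at hle hne
  set K' := (frobenius F p).fieldRange with hK'
  have hfd : FiniteDimensional K' F := FiniteDimensional.of_finrank_pos (Nat.pos_of_ne_zero hne)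
  -- X^p - f^p is irreducible over F^p, so F^p(f) has degree p ≥ [F : F^p] and is all of F.
  let b : K' := ⟨f ^ p, f, rfl⟩
  have hirr : Irreducible (Polynomial.X ^ p - Polynomial.C b) := by
    refine X_pow_sub_C_irreducible_of_prime Fact.out ?_
    rintro ⟨_, x, rfl⟩ hx
    have h1 : (frobenius F p x) ^ p = f ^ p := congrArg Subtype.val hx
    exact hf x (frobenius_inj F p h1)
  have hroot : Polynomial.aeval f (Polynomial.X ^ p - Polynomial.C b) = 0 := by
    simp [b, Algebra.algebraMap_ofSubsemiring_apply]
  have hmonic : (Polynomial.X ^ p - Polynomial.C b).Monic :=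
    Polynomial.monic_X_pow_sub_C b (Fact.out : p.Prime).ne_zero
  have hint : IsIntegral K' f := ⟨_, hmonic, hroot⟩
  have hmin := minpoly.eq_of_irreducible_of_monic hirr hroot hmonic
  have hdeg : finrank K' (IntermediateField.adjoin K' {f}) = p := by
    rw [IntermediateField.adjoin.finrank hint, ← hmin, Polynomial.natDegree_X_pow_sub_C]
  have htop : IntermediateField.adjoin K' {f} = ⊤ := by
    apply IntermediateField.eq_of_le_of_finrank_le le_top
    rw [IntermediateField.finrank_top', hdeg]
    exact hle
  have ha : a ∈ IntermediateField.adjoin K' {f} := htop ▸ IntermediateField.mem_top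
  obtain ⟨q, hq, hqa⟩ := (IntermediateField.adjoin.powerBasis hint).exists_eq_aeval
    (⟨a, ha⟩ : IntermediateField.adjoin K' {f})
  rw [IntermediateField.adjoin.powerBasis_dim, ← hmin, Polynomial.natDegree_X_pow_sub_C] at hq
  rw [IntermediateField.adjoin.powerBasis_gen] at hqa
  have hqa' : a = Polynomial.aeval f q := by
    have := congrArg (IntermediateField.val _) hqa
    rw [← Polynomial.aeval_algHom_apply] at this
    simpa using! this
  choose g hg using fun i => (q.coeff i).2
  refine ⟨g, ?_⟩
  rw [hqa', Polynomial.aeval_eq_sum_range' hq]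
  refine Finset.sum_congr rfl fun i _ => ?_
  rw [Algebra.smul_def]
  congr 1
  exact (hg i).symm

theorem Derivation.pow_char {R S M : Type*} [CommRing R] [CommRing S] [Algebra R S]
    [AddCommGroup M] [Module R M] [Module S M] (p : ℕ) [CharP S p]
    (d : Derivation R S M) (x : S) : d (x ^ p) = 0 := by
  rw [Derivation.leibniz_pow, ← Nat.cast_smul_eq_nsmul S, CharP.cast_eq_zero, zero_smul]

/-- The p-th powers are constants for d. At i = 0 the truncated exponent i - 1 is harmless because
its coefficient is 0. -/
theorem Derivation.sum_pow_char {R S M : Type*} [CommRing R] [CommRing S] [Algebra R S]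
    [AddCommGroup M] [Module R M] [Module S M] (p : ℕ) [CharP S p]
    (d : Derivation R S M) (c : ℕ → S) (f : S) :
    d (∑ i ∈ Finset.range p, c i ^ p * f ^ i) =
      (∑ i ∈ Finset.range p, (i : S) * c i ^ p * f ^ (i - 1)) • d f := by
  rw [map_sum, Finset.sum_smul]
  refine Finset.sum_congr rfl fun i _ => ?_
  rw [Derivation.leibniz, Derivation.pow_char p d, smul_zero, add_zero, Derivation.leibniz_pow,
    ← Nat.cast_smul_eq_nsmul S, smul_smul, smul_smul]
  congr 1
  ring

end PBasis

/-! ### Valuations of p-basis expansions -/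

section Valuation

theorem Valuation.le_sum_pow_of_uniformizer {F : Type*} [Field F] (v : Valuation F ℤᵐ⁰) {t : F}
    (ht : v t = WithZero.exp (-1)) (p : ℕ) (c : ℕ → F) {i : ℕ} (hi : i ∈ Finset.range p) :
    v (c i ^ p * t ^ i) ≤ v (∑ i ∈ Finset.range p, c i ^ p * t ^ i) := by
  classical
  obtain ⟨j, hj, hmax⟩ := Finset.exists_max_image (Finset.range p)
    (fun i => v (c i ^ p * t ^ i)) ⟨i, hi⟩
  by_cases h0 : v (c j ^ p * t ^ j) = 0
  -- If the largest value is 0, all terms vanish. Otherwise the maximum is attained only once, since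
  -- the order of c_l^p t^l is l mod p.
  · have := hmax i hi
    rw [h0] at this
    exact this.trans zero_le
  rw [v.map_sum_eq_of_lt hj]
  · exact hmax i hi
  intro l hl
  simp only [Finset.mem_sdiff, Finset.mem_singleton] at hl
  refine lt_of_le_of_ne (hmax l hl.1) fun heq => hl.2 ?_
  have h0' : v (c l ^ p * t ^ l) ≠ 0 := by rw [heq]; exact h0
  rw [map_mul, map_pow, map_pow, ht] at h0 h0'
  have hl0 := left_ne_zero_of_mul h0'
  have hj0 := left_ne_zero_of_mul h0
  have := congrArg WithZero.log heq
  rw [map_mul, map_pow, map_pow, ht, map_mul, map_pow, map_pow, ht,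
    WithZero.log_mul hl0 (by simp), WithZero.log_mul hj0 (by simp), WithZero.log_pow,
    WithZero.log_pow, WithZero.log_pow, WithZero.log_pow, WithZero.log_exp] at this
  simp only [nsmul_eq_mul, mul_neg, mul_one] at this
  have h1 : (p : ℤ) ∣ (l : ℤ) - j :=
    ⟨WithZero.log (v (c l)) - WithZero.log (v (c j)), by rw [mul_sub]; omega⟩
  have hlp := Finset.mem_range.1 hl.1
  have hjp := Finset.mem_range.1 hj
  have := Int.eq_zero_of_abs_lt_dvd h1 (by rw [abs_lt]; omega)
  omega

theorem Valuation.le_one_of_sum_pow_le_one {F : Type*} [Field F] (v : Valuation F ℤᵐ⁰) {t : F}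
    (ht : v t = WithZero.exp (-1)) (p : ℕ) (c : ℕ → F)
    (h : v (∑ i ∈ Finset.range p, c i ^ p * t ^ i) ≤ 1) {i : ℕ} (hi : i ∈ Finset.range p) :
    v (c i) ≤ 1 := by
  by_cases h0 : v (c i) = 0
  · rw [h0]; exact zero_le
  have h1 := (v.le_sum_pow_of_uniformizer ht p c hi).trans h
  have hip := Finset.mem_range.1 hi
  rw [map_mul, map_pow, map_pow, ht] at h1
  rw [← WithZero.log_le_log (by simp [h0]) one_ne_zero, WithZero.log_mul (by simp [h0]) (by simp),
    WithZero.log_pow, WithZero.log_pow, WithZero.log_exp, WithZero.log_one] at h1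
  rw [← WithZero.log_le_log h0 one_ne_zero, WithZero.log_one]
  simp only [nsmul_eq_mul, mul_neg, mul_one] at h1
  -- p·log v(c_i) ≤ i < p rules out log v(c_i) ≥ 1.
  by_contra hc
  nlinarith

end Valuation

/-! ### Normalized valuations of places -/

section PlaceBasics

variable {k F : Type*} [Field k] [Field F] [Algebra k F]

theorem Place.mem_ring_iff (P : Place k F) {x : F} : x ∈ P.ring ↔ P.val x ≤ 1 := by
  constructor
  · intro hx
    exact (IsDiscreteValuationRing.maximalIdeal P.ring).valuation_le_one (⟨x, hx⟩ : P.ring)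
  · intro hx
    obtain ⟨a, rfl⟩ := IsDiscreteValuationRing.exists_lift_of_le_one hx
    exact a.2

theorem Place.exists_uniformizer (P : Place k F) : ∃ t : F, P.val t = WithZero.exp (-1) :=
  (IsDiscreteValuationRing.maximalIdeal P.ring).valuation_exists_uniformizer F

theorem Place.valuationSubring_val (P : Place k F) : P.val.valuationSubring = P.ring := by
  ext x
  rw [P.mem_ring_iff, Valuation.mem_valuationSubring_iff]

theorem WithZero.lt_one_iff_le_exp_neg_one {x : ℤᵐ⁰} : x < 1 ↔ x ≤ WithZero.exp (-1) := by
  by_cases h : x = 0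
  · simp [h]
  rw [← WithZero.log_lt_log h one_ne_zero, ← WithZero.log_le_iff_le_exp h, WithZero.log_one]
  omega

/-- The ring determines a valuation up to equivalence, and an element of value exp (-1) fixes the
normalization. -/
theorem Place.val_eq_of_valuationSubring_eq (P : Place k F) (v : Valuation F ℤᵐ⁰)
    (hv : v.valuationSubring = P.ring) {t : F} (ht : v t = WithZero.exp (-1)) : v = P.val := by
  have heq : v.IsEquiv P.val := by
    rw [Valuation.isEquiv_iff_valuationSubring, hv, P.valuationSubring_val]
  obtain ⟨s, hs⟩ := P.exists_uniformizer
  have h1 : P.val t ≤ WithZero.exp (-1) := by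
    rw [← WithZero.lt_one_iff_le_exp_neg_one, ← heq.lt_one_iff_lt_one,
      WithZero.lt_one_iff_le_exp_neg_one, ht]
  have h2 : v s ≤ v t := by
    rw [ht, ← WithZero.lt_one_iff_le_exp_neg_one, heq.lt_one_iff_lt_one,
      WithZero.lt_one_iff_le_exp_neg_one, hs]
  have h3 : P.val t = WithZero.exp (-1) := le_antisymm h1 (hs ▸ (heq s t).1 h2)
  ext x
  by_cases hx : x = 0
  · simp [hx]
  have hvx : v x ≠ 0 := (Valuation.ne_zero_iff _).2 hx
  have hx' := WithZero.exp_log hvx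
  have h4 : v (x * t ^ WithZero.log (v x)) = 1 := by
    rw [map_mul, map_zpow₀, ht, ← WithZero.exp_zsmul, ← hx', ← WithZero.exp_add, WithZero.log_exp]
    simp
  have h5 := heq.eq_one_iff_eq_one.1 h4
  rw [map_mul, map_zpow₀, h3, ← WithZero.exp_zsmul] at h5
  rw [eq_comm, ← hx', ← mul_one (WithZero.exp _), ← h5, mul_comm, mul_assoc, ← WithZero.exp_add]
  simp

theorem Place.val_natCast_le_one (P : Place k F) (i : ℕ) : P.val (i : F) ≤ 1 := by
  rw [← P.mem_ring_iff]
  exact natCast_mem _ i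

theorem Place.eq_zero_or_le_ord_iff (P : Place k F) {x : F} {n : ℤ} :
    (x = 0 ∨ n ≤ P.ord x) ↔ P.val x ≤ WithZero.exp (-n) := by
  by_cases hx : x = 0
  · simp [hx]
  · rw [P.le_ord_iff hx]
    simp [hx]

theorem Place.ord_mul (P : Place k F) {x y : F} (hx : x ≠ 0) (hy : y ≠ 0) :
    P.ord (x * y) = P.ord x + P.ord y := by
  rw [Place.ord, map_mul, WithZero.log_mul ((Valuation.ne_zero_iff _).2 hx)
    ((Valuation.ne_zero_iff _).2 hy), Place.ord, Place.ord, neg_add]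

end PlaceBasics

/-! ### Differentials of a function field and their local lattices -/

section OneDimensional

theorem KaehlerDifferential.exists_eq_smul_D_of_forall {k F : Type*} [CommRing k] [CommRing F]
    [Algebra k F] {f : F}
    (h : ∀ a, ∃ g : F, KaehlerDifferential.D k F a = g • KaehlerDifferential.D k F f)
    (ω : Ω[F⁄k]) : ∃ g : F, ω = g • KaehlerDifferential.D k F f := by
  have : ω ∈ Submodule.span F (Set.range (KaehlerDifferential.D k F)) := by
    rw [KaehlerDifferential.span_range_derivation]; trivial
  induction this using Submodule.span_induction with
  | mem x hx => obtain ⟨a, rfl⟩ := hx; exact h a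
  | zero => exact ⟨0, by simp⟩
  | add x y _ _ hx hy =>
    obtain ⟨g, rfl⟩ := hx
    obtain ⟨g', rfl⟩ := hy
    exact ⟨g + g', by rw [add_smul]⟩
  | smul c x _ hx =>
    obtain ⟨g, rfl⟩ := hx
    exact ⟨c * g, by rw [mul_smul]⟩

variable {k F : Type*} [Field k] [Field F] [Algebra k F]

/-- If Ω vanished, F would be formally unramified and essentially of finite type over k, hence
separable algebraic, against the transcendence of t. -/
theorem IsCurveFunctionField.nontrivial_differentials [PerfectField k]
    (hF : IsCurveFunctionField k F) : Nontrivial Ω[F⁄k] := by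
  obtain ⟨t, ht, hfin⟩ := hF
  by_contra hn
  rw [not_nontrivial_iff_subsingleton] at hn
  have : Algebra.FormallyUnramified k F := ⟨hn⟩
  have h1 : Algebra.EssFiniteType k (IntermediateField.adjoin k {t}) :=
    IntermediateField.essFiniteType_iff.2
      ⟨{t}, by simp⟩
  have : Algebra.EssFiniteType k F := Algebra.EssFiniteType.comp k (IntermediateField.adjoin k {t}) F
  have := Algebra.FormallyUnramified.isSeparable k F
  exact ht (Algebra.IsAlgebraic.isAlgebraic t)

theorem exists_prime_charP (k F : Type*) [Field k] [Field F] [Algebra k F] [Finite k] :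
    ∃ p : ℕ, Fact p.Prime ∧ CharP k p ∧ CharP F p ∧ PerfectRing k p := by
  obtain ⟨p, hp⟩ := CharP.exists k
  have : Fact p.Prime := ⟨CharP.char_is_prime k p⟩
  exact ⟨p, this, hp, charP_of_injective_algebraMap (algebraMap k F).injective p, inferInstance⟩

variable [Finite k]

theorem IsCurveFunctionField.exists_eq_smul_D_of_not_pow (hF : IsCurveFunctionField k F) (p : ℕ)
    [Fact p.Prime] [CharP k p] [CharP F p] {f : F}
    (hf : ∀ b : F, b ^ p ≠ f) (ω : Ω[F⁄k]) :
    ∃ g : F, ω = g • KaehlerDifferential.D k F f := by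
  refine KaehlerDifferential.exists_eq_smul_D_of_forall (fun a => ?_) ω
  obtain ⟨c, rfl⟩ := hF.exists_eq_sum_pow p hf a
  exact ⟨_, Derivation.sum_pow_char p _ c f⟩

theorem IsCurveFunctionField.exists_eq_smul_D (hF : IsCurveFunctionField k F) {f : F}
    (hf : KaehlerDifferential.D k F f ≠ 0) (ω : Ω[F⁄k]) :
    ∃ g : F, ω = g • KaehlerDifferential.D k F f := by
  obtain ⟨p, _, _, _, _⟩ := exists_prime_charP k F
  refine hF.exists_eq_smul_D_of_not_pow p ?_ ω
  rintro b rfl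
  exact hf (Derivation.pow_char p _ b)

theorem IsCurveFunctionField.exists_D_ne_zero (hF : IsCurveFunctionField k F) :
    ∃ f : F, KaehlerDifferential.D k F f ≠ 0 := by
  have := hF.nontrivial_differentials
  by_contra! h
  obtain ⟨ω, hω⟩ := exists_ne (0 : Ω[F⁄k])
  obtain ⟨g, rfl⟩ := KaehlerDifferential.exists_eq_smul_D_of_forall (f := (0 : F))
    (fun a => ⟨0, by simp [h]⟩) ω
  simp at hω

theorem Valuation.pow_ne_of_uniformizer (v : Valuation F ℤᵐ⁰) {t : F}
    (ht : v t = WithZero.exp (-1)) {p : ℕ} (hp : p.Prime) (b : F) : b ^ p ≠ t := by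
  rintro rfl
  rw [map_pow] at ht
  have := congrArg WithZero.log ht
  rw [WithZero.log_pow, WithZero.log_exp, nsmul_eq_mul] at this
  have h1 : (p : ℤ) ∣ 1 := ⟨-WithZero.log (v b), by rw [mul_neg]; omega⟩
  have := Int.natCast_dvd_natCast.1 (by simpa using h1 : (p : ℤ) ∣ ((1 : ℕ) : ℤ))
  exact hp.one_lt.ne' (Nat.dvd_one.1 this)

theorem Valuation.derivative_sum_le_one (v : Valuation F ℤᵐ⁰) {t : F}
    (ht : v t = WithZero.exp (-1)) (p : ℕ) [CharP F p] (c : ℕ → F)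
    (h : v (∑ i ∈ Finset.range p, c i ^ p * t ^ i) ≤ 1) (hnat : ∀ i : ℕ, v (i : F) ≤ 1) :
    v (∑ i ∈ Finset.range p, (i : F) * c i ^ p * t ^ (i - 1)) ≤ 1 := by
  refine v.map_sum_le fun i hi => ?_
  have ht1 : v t ≤ 1 := (WithZero.lt_one_iff_le_exp_neg_one.2 ht.le).le
  rw [map_mul, map_mul, map_pow, map_pow]
  exact mul_le_one' (mul_le_one' (hnat i)
    (pow_le_one' (v.le_one_of_sum_pow_le_one ht p c h hi) _)) (pow_le_one' ht1 _)

theorem Place.D_uniformizer_ne_zero (hF : IsCurveFunctionField k F) (P : Place k F) {t : F}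
    (ht : P.val t = WithZero.exp (-1)) : KaehlerDifferential.D k F t ≠ 0 := by
  obtain ⟨p, hp, _, _, _⟩ := exists_prime_charP k F
  obtain ⟨f, hf⟩ := hF.exists_D_ne_zero
  obtain ⟨g, hg⟩ := hF.exists_eq_smul_D_of_not_pow p
    (P.val.pow_ne_of_uniformizer ht hp.out) (KaehlerDifferential.D k F f)
  intro h0
  rw [h0, smul_zero] at hg
  exact hf hg

/-- This is Ω_P = 𝒪_P dt: the p-basis expansion of an integral element in t has integral
coefficients, so it can be differentiated term by term inside 𝒪_P. -/
theorem Place.exists_D_eq_smul (hF : IsCurveFunctionField k F) (P : Place k F) {t : F}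
    (ht : P.val t = WithZero.exp (-1)) {a : F} (ha : P.val a ≤ 1) :
    ∃ g : F, P.val g ≤ 1 ∧ KaehlerDifferential.D k F a = g • KaehlerDifferential.D k F t := by
  obtain ⟨p, hp, _, _, _⟩ := exists_prime_charP k F
  obtain ⟨c, rfl⟩ := hF.exists_eq_sum_pow p (P.val.pow_ne_of_uniformizer ht hp.out) a
  exact ⟨_, P.val.derivative_sum_le_one ht p c ha P.val_natCast_le_one,
    Derivation.sum_pow_char p _ c t⟩

theorem Place.smul_D_mem_diffLattice_iff (hF : IsCurveFunctionField k F) (P : Place k F) {t : F}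
    (ht : P.val t = WithZero.exp (-1)) {g : F} {n : ℤ} :
    g • KaehlerDifferential.D k F t ∈ P.diffLattice n ↔ P.val g ≤ WithZero.exp (-n) := by
  constructor
  · intro h
    suffices ∀ ω ∈ P.diffLattice n, ∃ x : F, P.val x ≤ WithZero.exp (-n) ∧
        ω = x • KaehlerDifferential.D k F t by
      obtain ⟨x, hx, hgx⟩ := this _ h
      rwa [smul_left_injective F (P.D_uniformizer_ne_zero hF ht) hgx]
    intro ω hω
    induction hω using Submodule.span_induction with
    | mem ω hω =>
      obtain ⟨x, a, hx, ha, rfl⟩ := hω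
      obtain ⟨c, hc, hca⟩ := P.exists_D_eq_smul hF ht (P.mem_ring_iff.1 ha)
      refine ⟨x * c, ?_, by rw [hca, smul_smul]⟩
      rw [map_mul]
      exact (mul_le_of_le_one_right' hc).trans (P.eq_zero_or_le_ord_iff.1 hx)
    | zero => exact ⟨0, by simp, by simp⟩
    | add x y _ _ hx hy =>
      obtain ⟨g, hg, rfl⟩ := hx
      obtain ⟨g', hg', rfl⟩ := hy
      exact ⟨g + g', P.val.map_add_le hg hg', by rw [add_smul]⟩
    | smul c x _ hx =>
      obtain ⟨g, hg, rfl⟩ := hx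
      refine ⟨algebraMap k F c * g, ?_, by rw [mul_smul, algebraMap_smul]⟩
      rw [map_mul]
      exact (mul_le_of_le_one_left' (P.val_algebraMap_le_one c)).trans hg
  · intro h
    refine Submodule.subset_span ⟨g, t, P.eq_zero_or_le_ord_iff.2 h, ?_, rfl⟩
    rw [P.mem_ring_iff]
    exact (WithZero.lt_one_iff_le_exp_neg_one.2 ht.le).le

theorem Place.ordDiff_smul_D (hF : IsCurveFunctionField k F) (P : Place k F) {t : F}
    (ht : P.val t = WithZero.exp (-1)) {g : F} (hg : g ≠ 0) :
    P.ordDiff (g • KaehlerDifferential.D k F t) = P.ord g := by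
  -- The set is bounded above and contains its bound, so the supremum is a genuine maximum.
  have : {n : ℤ | g • KaehlerDifferential.D k F t ∈ P.diffLattice n} = Set.Iic (P.ord g) := by
    ext n
    rw [Set.mem_ofPred_eq, P.smul_D_mem_diffLattice_iff hF ht, Set.mem_Iic, P.le_ord_iff hg]
  rw [Place.ordDiff, this, csSup_Iic]

theorem Place.smul_mem_diffLattice_iff (hF : IsCurveFunctionField k F) (P : Place k F) {f g : F}
    (hf : KaehlerDifferential.D k F f ≠ 0) {n : ℤ} :
    g • KaehlerDifferential.D k F f ∈ P.diffLattice (-n) ↔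
      g = 0 ∨ 0 ≤ P.ord g + (P.ordDiff (KaehlerDifferential.D k F f) + n) := by
  obtain ⟨t, ht⟩ := P.exists_uniformizer
  obtain ⟨h, hh⟩ := hF.exists_eq_smul_D (P.D_uniformizer_ne_zero hF ht)
    (KaehlerDifferential.D k F f)
  have h0 : h ≠ 0 := by
    rintro rfl
    exact hf (by rw [hh, zero_smul])
  by_cases hg : g = 0
  · simp [hg]
  rw [hh, P.ordDiff_smul_D hF ht h0, smul_smul, P.smul_D_mem_diffLattice_iff hF ht,
    ← P.le_ord_iff (mul_ne_zero hg h0), P.ord_mul hg h0]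
  simp only [hg, false_or]
  omega

theorem smul_mem_diffSpace_iff (hF : IsCurveFunctionField k F) {f : F}
    (hf : KaehlerDifferential.D k F f ≠ 0) (D : Place k F → ℤ) (g : F) :
    g • KaehlerDifferential.D k F f ∈ diffSpace D ↔
      g ∈ rrSpace (fun P : Place k F => P.ordDiff (KaehlerDifferential.D k F f) + D P) := by
  rw [diffSpace, Submodule.mem_iInf]
  simp only [Place.smul_mem_diffLattice_iff hF _ hf]
  exact forall_or_left

end OneDimensional

/-! ### Finite extensions of function fields -/

section Tower

theorem IsCurveFunctionField.of_finite {k F E : Type*} [Field k] [Field F] [Field E] [Algebra k F]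
    [Algebra k E] [Algebra F E] [IsScalarTower k F E] [FiniteDimensional F E]
    (hF : IsCurveFunctionField k F) : IsCurveFunctionField k E := by
  obtain ⟨t, ht, hfin⟩ := hF
  refine ⟨algebraMap F E t, (transcendental_algebraMap_iff (algebraMap F E).injective).2 ht, ?_⟩
  have hmap : (IntermediateField.adjoin k {t}).map (IsScalarTower.toAlgHom k F E) =
      IntermediateField.adjoin k {algebraMap F E t} := by
    rw [IntermediateField.adjoin_map, Set.image_singleton]
    rfl
  have h1 : FiniteDimensional (IntermediateField.adjoin k {t}) E :=
    FiniteDimensional.trans _ F E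
  rw [← hmap]
  let e := (IntermediateField.adjoin k {t}).equivMap (IsScalarTower.toAlgHom k F E)
  exact Module.Finite.of_equiv_equiv e.toRingEquiv (RingEquiv.refl E) (by ext x; rfl)

end Tower

/-! ### Places above P and primes of the integral closure -/

namespace Place

open IsDedekindDomain

section General

variable {k F E : Type*} [Field k] [Field F] [Field E] [Algebra k F] [Algebra F E]

theorem liesOver_maximalIdeal (P : Place k F) (w : Ideal (P.intClosure E)) [w.IsMaximal] :
    w.LiesOver (IsDiscreteValuationRing.maximalIdeal P.ring).asIdeal := by
  refine ⟨?_⟩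
  have : (w.under P.ring).IsMaximal := Ideal.isMaximal_comap_of_isIntegral_of_isMaximal w
  exact (IsLocalRing.eq_maximalIdeal this).symm

theorem ring_ne_top (P : Place k F) : P.ring ≠ ⊤ := by
  intro h
  obtain ⟨t, ht⟩ := P.exists_uniformizer
  have : t⁻¹ ∈ P.ring := h ▸ ValuationSubring.mem_top _
  rw [P.mem_ring_iff, map_inv₀, ht, ← WithZero.exp_neg, ← WithZero.exp_zero, WithZero.exp_le_exp] at this
  omega

theorem ne_zero_of_val_eq_exp (P : Place k F) {t : F} {n : ℤ} (ht : P.val t = WithZero.exp n) :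
    t ≠ 0 := by
  rintro rfl
  rw [map_zero] at ht
  exact WithZero.exp_ne_zero ht.symm

theorem LiesAbove.mem_iff [Algebra k E] {P : Place k F} {Q : Place k E} (h : Q.LiesAbove P)
    (x : F) : Q.val (algebraMap F E x) ≤ 1 ↔ P.val x ≤ 1 := by
  rw [← Q.mem_ring_iff, ← P.mem_ring_iff, ← ValuationSubring.mem_comap, h]

theorem LiesAbove.mem_center_iff [Algebra k E] {P : Place k F} {Q : Place k E} (h : Q.LiesAbove P)
    (b : P.intClosure E) : b ∈ h.center ↔ Q.val (b : E) < 1 := by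
  have := (IsDiscreteValuationRing.maximalIdeal Q.ring).valuation_lt_one_iff_mem (K := E)
    (⟨b, h.intClosure_mem b⟩ : Q.ring)
  exact this.symm

/-- The restriction of the ring of Q to F is again a discrete valuation ring: a nonzero ideal is
generated by any element of least order at Q, and the restriction is not a field because E is
integral over F. -/
theorem exists_center [Algebra k E] [IsScalarTower k F E] [FiniteDimensional F E] (Q : Place k E) :
    ∃ P : Place k F, Q.LiesAbove P := by
  let R : ValuationSubring F := Q.ring.comap (algebraMap F E)
  have hR : ∀ x : F, x ∈ R ↔ Q.val (algebraMap F E x) ≤ 1 := fun x => by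
    rw [ValuationSubring.mem_comap, Q.mem_ring_iff]
  have hpir : IsPrincipalIdealRing R := by
    refine ⟨fun I => ?_⟩
    by_cases hI : I = ⊥
    · rw [hI]; infer_instance
    obtain ⟨x, hx, hx0⟩ := Submodule.exists_mem_ne_zero_of_ne_bot hI
    let S : Set ℕ := {n | ∃ x ∈ I, x ≠ 0 ∧
      Q.val (algebraMap F E (x : F)) = WithZero.exp (-(n : ℤ))}
    have hS : ∀ x ∈ I, x ≠ 0 → ∃ n ∈ S, Q.val (algebraMap F E (x : F)) =
        WithZero.exp (-(n : ℤ)) := by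
      intro x hx hx0
      have h0 : Q.val (algebraMap F E (x : F)) ≠ 0 := by simpa using hx0
      have h1 := (hR x).1 x.2
      rw [← WithZero.log_le_log h0 one_ne_zero, WithZero.log_one] at h1
      have : Q.val (algebraMap F E (x : F)) =
          WithZero.exp (-(((-WithZero.log (Q.val (algebraMap F E (x : F)))).toNat : ℕ) : ℤ)) := by
        rw [Int.toNat_of_nonneg (by omega), neg_neg, WithZero.exp_log h0]
      exact ⟨_, ⟨x, hx, hx0, this⟩, this⟩
    obtain ⟨n, hn, -⟩ := hS x hx hx0
    obtain ⟨y, hy, hy0, hyn⟩ := Nat.sInf_mem ⟨n, hn⟩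
    refine ⟨⟨y, le_antisymm (fun z hz => ?_) ((Submodule.span_singleton_le_iff_mem _ _).2 hy)⟩⟩
    by_cases hz0 : z = 0
    · rw [hz0]; exact zero_mem _
    obtain ⟨m, hm, hzm⟩ := hS z hz hz0
    have hle := Nat.sInf_le hm
    have hy0' : (y : F) ≠ 0 := by simpa using hy0
    have hmem : (z : F) / y ∈ R := by
      rw [hR, map_div₀, map_div₀, hzm, hyn, ← WithZero.exp_sub, ← WithZero.exp_zero, WithZero.exp_le_exp]
      omega
    refine Ideal.mem_span_singleton.2 ⟨⟨_, hmem⟩, ?_⟩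
    apply Subtype.ext
    simp [mul_div_cancel₀ _ hy0']
  have hfield : ¬ IsField R := by
    intro hfld
    apply Q.ring_ne_top
    rw [eq_top_iff]
    intro x _
    -- A valuation ring that is a field is all of F; then the integrally closed ring of Q contains
    -- E.
    have hFR : ∀ y : F, y ∈ R := by
      intro y
      rcases R.mem_or_inv_mem y with hy | hy
      · exact hy
      by_cases hy0 : y = 0
      · rw [hy0]; exact zero_mem _
      obtain ⟨z, hz⟩ := hfld.mul_inv_cancel (a := (⟨_, hy⟩ : R))
        (fun h => inv_ne_zero hy0 (congrArg Subtype.val h))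
      have hz' : y⁻¹ * (z : F) = 1 := congrArg Subtype.val hz
      rw [inv_mul_eq_one₀ hy0] at hz'
      rw [hz']
      exact z.2
    let φ : F →+* Q.ring := (algebraMap F E).codRestrict Q.ring hFR
    obtain ⟨q, hq, hqx⟩ := Algebra.IsIntegral.isIntegral (R := F) x
    have hi : IsIntegral Q.ring x := ⟨q.map φ, hq.map φ, by rw [Polynomial.eval₂_map]; exact hqx⟩
    obtain ⟨y, rfl⟩ := IsIntegrallyClosed.isIntegral_iff.1 hi
    exact y.2
  have hdvr : IsDiscreteValuationRing R :=
    { hpir, (inferInstance : IsLocalRing R) with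
      not_a_field' := fun h => hfield (IsLocalRing.isField_iff_maximalIdeal_eq.2 h) }
  exact ⟨⟨R, fun c => by
    rw [hR, ← IsScalarTower.algebraMap_apply]
    exact Q.val_algebraMap_le_one c, hdvr⟩, rfl⟩

end General

section Separable

variable {k F E : Type*} [Field k] [Field F] [Field E] [Algebra k F]
  [Algebra F E] [FiniteDimensional F E] [Algebra.IsSeparable F E]

instance (P : Place k F) : IsFractionRing (P.intClosure E) E :=
  integralClosure.isFractionRing_of_finite_extension F E

instance (P : Place k F) : Module.Finite P.ring (P.intClosure E) :=
  IsIntegralClosure.finite P.ring F E (P.intClosure E)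

variable (P : Place k F)

theorem val_pow_eq (w : HeightOneSpectrum (P.intClosure E)) (x : F) :
    w.valuation E (algebraMap F E x) = P.val x ^ w.asIdeal.ramificationIdx P.ring := by
  have : w.asIdeal.IsMaximal := w.isMaximal
  have := P.liesOver_maximalIdeal w.asIdeal
  have := w.isPrime
  rw [← HeightOneSpectrum.valuation_liesOver E (IsDiscreteValuationRing.maximalIdeal P.ring) w,
    Ideal.ramificationIdx'_eq_ramificationIdx _ _
      (IsDiscreteValuationRing.maximalIdeal P.ring).ne_bot]
  rfl

theorem ramificationIdx_pos (w : HeightOneSpectrum (P.intClosure E)) :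
    0 < w.asIdeal.ramificationIdx P.ring := by
  have := w.isPrime
  exact Ideal.ramificationIdx_pos _ _

theorem valuation_algebraMap_le_one_iff (w : HeightOneSpectrum (P.intClosure E)) (x : F) :
    w.valuation E (algebraMap F E x) ≤ 1 ↔ P.val x ≤ 1 := by
  rw [P.val_pow_eq w, pow_le_one_iff (P.ramificationIdx_pos w).ne']

variable (E) in
theorem nonempty_heightOneSpectrum : Nonempty (HeightOneSpectrum (P.intClosure E)) := by
  obtain ⟨Q, hQ, hQP⟩ := (inferInstance : Nonempty
    (Ideal.primesOver (IsDiscreteValuationRing.maximalIdeal P.ring).asIdeal (P.intClosure E)))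
  exact ⟨⟨Q, hQ, Ideal.ne_bot_of_liesOver_of_ne_bot
    (IsDiscreteValuationRing.maximalIdeal P.ring).ne_bot Q⟩⟩

instance : Finite (HeightOneSpectrum (P.intClosure E)) := by
  have : Finite (Ideal.primesOver (IsDiscreteValuationRing.maximalIdeal P.ring).asIdeal
      (P.intClosure E)) := by
    have := (IsDiscreteValuationRing.maximalIdeal P.ring).isMaximal
    exact (IsDedekindDomain.primesOver_finite _ (P.intClosure E)).to_subtype
  refine Finite.of_injective (β := Ideal.primesOver
    (IsDiscreteValuationRing.maximalIdeal P.ring).asIdeal (P.intClosure E))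
    (fun w => ⟨w.asIdeal, w.isPrime, ?_⟩) ?_
  · have := w.isMaximal
    exact P.liesOver_maximalIdeal w.asIdeal
  · intro w w' h
    exact HeightOneSpectrum.ext (congrArg Subtype.val h)

section Places

variable [Algebra k E] [IsScalarTower k F E]

/-- The place of `E` given by a prime ideal of the integral closure of the ring of a place of
`F`. -/
noncomputable def ofPrime (w : HeightOneSpectrum (P.intClosure E)) : Place k E where
  ring := (w.valuation E).valuationSubring
  algebraMap_mem c := by
    rw [Valuation.mem_valuationSubring_iff, IsScalarTower.algebraMap_apply k F E,
      P.valuation_algebraMap_le_one_iff w]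
    exact P.val_algebraMap_le_one c
  isDVR := by
    rw [← HeightOneSpectrum.valuationSubringAtPrime_eq_valuationSubring]
    exact IsLocalization.AtPrime.isDiscreteValuationRing_of_dedekind_domain _ w.ne_bot _

theorem val_ofPrime (w : HeightOneSpectrum (P.intClosure E)) :
    (P.ofPrime w).val = w.valuation E := by
  obtain ⟨t, ht⟩ := w.valuation_exists_uniformizer E
  exact ((P.ofPrime w).val_eq_of_valuationSubring_eq _ rfl ht).symm

theorem ofPrime_liesAbove (w : HeightOneSpectrum (P.intClosure E)) :
    (P.ofPrime w).LiesAbove P := by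
  ext x
  rw [ValuationSubring.mem_comap, Place.mem_ring_iff, val_ofPrime,
    P.valuation_algebraMap_le_one_iff w, P.mem_ring_iff]

variable (E) in
theorem exists_liesAbove : ∃ Q : Place k E, Q.LiesAbove P :=
  let ⟨w⟩ := P.nonempty_heightOneSpectrum E
  ⟨_, P.ofPrime_liesAbove w⟩

variable {P} {Q : Place k E}

omit [IsScalarTower k F E] in
-- The localization of the integral closure at the center lies in the ring of Q. It is a discrete
-- valuation ring, so its only overrings are itself and E. The center is nonzero because it contains
-- a uniformizer of P.
theorem LiesAbove.exists_prime (h : Q.LiesAbove P) :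
    ∃ w : HeightOneSpectrum (P.intClosure E), w.asIdeal = h.center ∧ w.valuation E = Q.val := by
  have hprime : h.center.IsPrime := Ideal.IsPrime.comap _
  have hbot : h.center ≠ ⊥ := by
    obtain ⟨t, ht⟩ := P.exists_uniformizer
    have ht1 : t ∈ P.ring := by
      rw [P.mem_ring_iff]
      exact (WithZero.lt_one_iff_le_exp_neg_one.2 ht.le).le
    have hQ : Q.val (algebraMap F E t) < 1 := by
      by_contra! hc
      have h1 := inv_le_one_of_one_le₀ hc
      rw [← map_inv₀, ← map_inv₀, h.mem_iff, map_inv₀, ht, ← WithZero.exp_neg,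
        ← WithZero.exp_zero, WithZero.exp_le_exp] at h1
      omega
    refine (Submodule.ne_bot_iff _).2 ⟨algebraMap P.ring _ ⟨t, ht1⟩, (h.mem_center_iff _).2 hQ, ?_⟩
    intro h0
    have h1 := congrArg (fun b : P.intClosure E => (b : E)) h0
    exact P.ne_zero_of_val_eq_exp ht ((algebraMap F E).injective (by rw [map_zero]; exact h1))
  let w : HeightOneSpectrum (P.intClosure E) := ⟨h.center, hprime, hbot⟩
  refine ⟨w, rfl, ?_⟩
  obtain ⟨t, ht⟩ := w.valuation_exists_uniformizer E
  refine Q.val_eq_of_valuationSubring_eq _ ?_ ht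
  rw [← HeightOneSpectrum.valuationSubringAtPrime_eq_valuationSubring]
  refine ValuationSubring.eq_of_le_of_ne_top _ (fun x hx => ?_) Q.ring_ne_top
  rw [HeightOneSpectrum.valuationSubringAtPrime_eq_valuationSubring] at hx
  obtain ⟨n, d, hnd⟩ := w.exists_primeCompl_mul_eq_of_integer x hx
  have hd : Q.val ((d : P.intClosure E) : E) = 1 := by
    refine le_antisymm (Q.mem_ring_iff.1 (h.intClosure_mem _)) ?_
    rw [← not_lt, ← h.mem_center_iff]
    exact d.2
  rw [Q.mem_ring_iff, ← mul_one (Q.val x), ← hd, ← map_mul, hd]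
  exact (congrArg Q.val hnd).trans_le (Q.mem_ring_iff.1 (h.intClosure_mem n))

omit [IsScalarTower k F E] in
theorem LiesAbove.val_algebraMap (h : Q.LiesAbove P) (x : F) :
    Q.val (algebraMap F E x) = P.val x ^ h.ramIdx := by
  obtain ⟨w, hw, hv⟩ := h.exists_prime
  rw [← hv, P.val_pow_eq w, hw, LiesAbove.ramIdx]

omit [IsScalarTower k F E] in
theorem LiesAbove.ramIdx_pos (h : Q.LiesAbove P) : 0 < h.ramIdx := by
  obtain ⟨w, hw, hv⟩ := h.exists_prime
  rw [LiesAbove.ramIdx, ← hw]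
  exact P.ramificationIdx_pos w

omit [IsScalarTower k F E] in
theorem LiesAbove.val_eq_exp_diffExp (h : Q.LiesAbove P) {u : P.intClosure E} (hu : u ≠ 0)
    (hd : differentIdeal P.ring (P.intClosure E) = Ideal.span {u}) :
    Q.val (u : E) = WithZero.exp (-(h.diffExp : ℤ)) := by
  obtain ⟨w, hw, hv⟩ := h.exists_prime
  rw [LiesAbove.diffExp, hd, ← hw, ← w.intValuation_eq_exp_neg_multiplicity hu, ← hv,
    ← w.valuation_of_algebraMap (K := E)]
  rfl

end Places

theorem mem_intClosure_of_valuation_le_one {x : E}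
    (h : ∀ w : HeightOneSpectrum (P.intClosure E), w.valuation E x ≤ 1) :
    ∃ b : P.intClosure E, (b : E) = x :=
  HeightOneSpectrum.mem_integers_of_valuation_le_one E x h

variable (E) in
theorem exists_simultaneous_uniformizer : ∃ t : P.intClosure E,
    ∀ w : HeightOneSpectrum (P.intClosure E), w.valuation E (t : E) = WithZero.exp (-1) := by
  classical
  cases nonempty_fintype (HeightOneSpectrum (P.intClosure E))
  choose x hx using fun w : HeightOneSpectrum (P.intClosure E) => w.intValuation_exists_uniformizer
  -- Chinese remainder theorem: agreeing with a uniformizer modulo the square of each prime forces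
  -- order exactly 1.
  obtain ⟨y, hy⟩ := IsDedekindDomain.exists_forall_sub_mem_ideal (s := Finset.univ)
    (fun w : HeightOneSpectrum (P.intClosure E) => w.asIdeal) (fun _ => 2)
    (fun w _ => w.prime) (fun w _ w' _ h h' => h (HeightOneSpectrum.ext h')) (fun w => x w)
  refine ⟨y, fun w => ?_⟩
  have h1 := hy w (Finset.mem_univ _)
  rw [← w.intValuation_le_pow_iff_mem] at h1
  have h2 := w.valuation_of_algebraMap (K := E) y
  refine h2.trans ?_
  rw [← hx w]
  apply Valuation.map_eq_of_sub_lt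
  refine h1.trans_lt ?_
  rw [hx w, WithZero.exp_lt_exp]
  norm_num

end Separable

end Place

/-! ### Kähler differentials and the different -/

section Different

open scoped TensorProduct

/-- If `Ω[B⁄A]` is generated by `dx` and `u dx = 0`, then `u` lies in the Noether different
of `B` over `A`. -/
theorem KaehlerDifferential.exists_annihilator_ideal {A B : Type*} [CommRing A] [CommRing B]
    [Algebra A B] [Algebra.EssFiniteType A B] {x u : B}
    (hx : ∀ ω : Ω[B⁄A], ∃ g : B, ω = g • KaehlerDifferential.D A B x)
    (hu : u • KaehlerDifferential.D A B x = 0) :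
    ∃ η : B ⊗[A] B, Algebra.TensorProduct.lmul' A η = u ∧
      ∀ y ∈ KaehlerDifferential.ideal A B, y * η = 0 := by
  set I := KaehlerDifferential.ideal A B with hI
  have hker : ∀ y ∈ I, Algebra.TensorProduct.lmul' A y = 0 := fun y hy => hy
  -- The class of ξ in I/I² is dx. So I = (ξ) + I² because dx generates, and (u ⊗ 1)ξ lies in I²
  -- because u dx = 0.
  let ξ : I := ⟨(1 : B) ⊗ₜ[A] x - x ⊗ₜ[A] (1 : B),
    KaehlerDifferential.one_smul_sub_smul_one_mem_ideal A x⟩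
  have hsm : ∀ g : B, g • KaehlerDifferential.D A B x = I.toCotangent ((g ⊗ₜ[A] (1 : B)) • ξ) := by
    intro g
    rw [map_smul]
    exact algebra_compatible_smul (B ⊗[A] B) g (KaehlerDifferential.D A B x)
  have h1 : I ≤ Ideal.span {(ξ : B ⊗[A] B)} ⊔ I • I := by
    intro y hy
    obtain ⟨g, hg⟩ := hx (I.toCotangent ⟨y, hy⟩)
    rw [hsm] at hg
    have h2 := (Ideal.toCotangent_eq I).1 hg
    rw [← sub_add_cancel y (g ⊗ₜ[A] (1 : B) * ξ)]
    refine add_mem (Submodule.mem_sup_right ?_) (Submodule.mem_sup_left ?_)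
    · rw [smul_eq_mul, ← pow_two]
      exact h2
    · exact Ideal.mul_mem_left _ _ (Ideal.mem_span_singleton_self _)
  have h2 : (u ⊗ₜ[A] (1 : B)) * (ξ : B ⊗[A] B) ∈ I ^ 2 := by
    rw [hsm] at hu
    exact (Ideal.toCotangent_eq_zero I _).1 hu
  -- Nakayama: some r ≡ 1 mod I satisfies r I ⊆ (ξ), hence r² I² ⊆ (ξ²).
  obtain ⟨r, hr, hrI⟩ := Submodule.exists_sub_one_mem_and_smul_le_of_fg_of_le_sup
    (KaehlerDifferential.ideal_fg A B) le_rfl h1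
  have hrI' : ∀ y ∈ I, ∃ β, r * y = β * ξ := by
    intro y hy
    have := hrI (Submodule.smul_mem_pointwise_smul y r I hy)
    obtain ⟨β, hβ⟩ := Ideal.mem_span_singleton'.1 this
    exact ⟨β, hβ.symm⟩
  have h3 : ∀ y ∈ I ^ 2, ∃ α, r ^ 2 * y = α * (ξ : B ⊗[A] B) ^ 2 := by
    intro y hy
    rw [pow_two] at hy
    induction hy using Submodule.mul_induction_on' with
    | mem_mul_mem m hm n hn =>
      obtain ⟨β, hβ⟩ := hrI' m hm
      obtain ⟨γ, hγ⟩ := hrI' n hn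
      exact ⟨β * γ, by linear_combination r * n * hβ + β * ξ * hγ⟩
    | add y _ z _ hy hz =>
      obtain ⟨β, hβ⟩ := hy
      obtain ⟨γ, hγ⟩ := hz
      exact ⟨β + γ, by linear_combination hβ + hγ⟩
  obtain ⟨α, hα⟩ := h3 _ h2
  -- Multiplication sends r to 1 and ξ to 0, so this goes to u. The second factor kills ξ because
  -- r²(u ⊗ 1)ξ = αξ², and the factor r moves any y in I into (ξ).
  refine ⟨r * (r ^ 2 * (u ⊗ₜ[A] (1 : B)) - α * ξ), ?_, ?_⟩
  · have hr1 : Algebra.TensorProduct.lmul' A r = 1 := by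
      have := hker _ hr
      rwa [map_sub, map_one, sub_eq_zero] at this
    rw [map_mul, map_sub, map_mul, map_pow, map_mul, hr1, hker _ ξ.2]
    simp
  · intro y hy
    obtain ⟨β, hβ⟩ := hrI' y hy
    linear_combination (r ^ 2 * (u ⊗ₜ[A] (1 : B)) - α * ξ) * hβ + β * hα

variable {A K B L : Type*} [CommRing A] [IsDomain A] [IsIntegrallyClosed A] [Field K]
  [CommRing B] [IsDedekindDomain B] [Field L] [Algebra A K] [IsFractionRing A K]
  [Algebra B L] [IsFractionRing B L] [Algebra A B] [Algebra K L] [Algebra A L]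
  [IsScalarTower A K L] [IsScalarTower A B L] [IsIntegralClosure B A L]
  [Module.IsTorsionFree A B] [FiniteDimensional K L]

variable (K L) in
theorem mem_differentIdeal_iff [Algebra.IsSeparable K L] {m : B} : m ∈ differentIdeal A B ↔
    ∀ x : L, (∀ b : B, Algebra.trace K L (x * algebraMap B L b) ∈ (algebraMap A K).range) →
      ∃ b : B, algebraMap B L b = algebraMap B L m * x := by
  have h1 : m ∈ differentIdeal A B ↔
      algebraMap B L m ∈ IsLocalization.coeSubmodule L (differentIdeal A B) := by
    constructor
    · exact fun h => ⟨m, h, rfl⟩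
    · rintro ⟨b, hb, hbm⟩
      rwa [← IsFractionRing.injective B L hbm]
  rw [h1, coeSubmodule_differentIdeal A K, Submodule.mem_div_iff_forall_mul_mem]
  refine forall_congr' fun x => ?_
  rw [Submodule.mem_traceDual, Submodule.mem_one]
  simp only [Submodule.mem_one, forall_exists_index, forall_apply_eq_imp_iff,
    Algebra.traceForm_apply]

variable (K L) in
-- Put ψ_σ(b ⊗ b') = σ(b)b'. Since η kills 1 ⊗ b - b ⊗ 1, ψ_σ(η) = 0 for σ ≠ 1. For c in the trace
-- dual, z ↦ ∑ σ(c)ψ_σ(z) sends b ⊗ b' to Tr(cb)b', so it has values in B; at η it gives c times the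
-- image of η under multiplication.
theorem mem_differentIdeal_of_annihilator [IsGalois K L] {η : B ⊗[A] B}
    (hη : ∀ y ∈ KaehlerDifferential.ideal A B, y * η = 0) :
    Algebra.TensorProduct.lmul' A η ∈ differentIdeal A B := by
  rw [mem_differentIdeal_iff K L]
  intro c hc
  let f : (L ≃ₐ[K] L) → B →ₐ[A] L := fun σ =>
    ((σ : L →ₐ[K] L).restrictScalars A).comp (IsScalarTower.toAlgHom A B L)
  let ψ : (L ≃ₐ[K] L) → B ⊗[A] B →ₐ[A] L := fun σ =>
    Algebra.TensorProduct.productMap (f σ) (IsScalarTower.toAlgHom A B L)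
  have hψ : ∀ σ b b', ψ σ (b ⊗ₜ b') = σ (algebraMap B L b) * algebraMap B L b' := by
    intro σ b b'
    rw [Algebra.TensorProduct.productMap_apply_tmul]
    rfl
  have hψ1 : ∀ z, ψ 1 z = algebraMap B L (Algebra.TensorProduct.lmul' A z) := by
    intro z
    induction z using TensorProduct.induction_on with
    | zero => simp
    | tmul b b' => rw [hψ, Algebra.TensorProduct.lmul'_apply_tmul, map_mul]; rfl
    | add y z hy hz => rw [map_add, hy, hz, map_add, map_add]
  have hψη : ∀ σ, σ ≠ 1 → ψ σ η = 0 := by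
    intro σ hσ
    obtain ⟨b, hb⟩ : ∃ b : B, σ (algebraMap B L b) ≠ algebraMap B L b := by
      by_contra! h
      refine hσ (AlgEquiv.ext fun x => ?_)
      obtain ⟨y, z, -, rfl⟩ := IsFractionRing.div_surjective (A := B) x
      rw [map_div₀, h, h]
      rfl
    have h0 := congrArg (ψ σ)
      (hη _ (KaehlerDifferential.one_smul_sub_smul_one_mem_ideal A b))
    rw [map_mul, map_zero, map_sub, hψ, hψ, map_one, map_one, one_mul, mul_one,
      mul_eq_zero, sub_eq_zero] at h0
    exact h0.resolve_left fun h => hb h.symm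
  have hmem : ∀ z : B ⊗[A] B, ∃ b : B, algebraMap B L b = ∑ σ, σ c * ψ σ z := by
    intro z
    induction z using TensorProduct.induction_on with
    | zero => exact ⟨0, by simp⟩
    | tmul b b' =>
      obtain ⟨a, ha⟩ := hc b
      refine ⟨algebraMap A B a * b', ?_⟩
      rw [map_mul, ← IsScalarTower.algebraMap_apply, IsScalarTower.algebraMap_apply A K L, ha,
        trace_eq_sum_automorphisms, Finset.sum_mul]
      exact Finset.sum_congr rfl fun σ _ => by rw [hψ, map_mul, mul_assoc]
    | add y z hy hz =>
      obtain ⟨b, hb⟩ := hy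
      obtain ⟨b', hb'⟩ := hz
      exact ⟨b + b', by simp only [map_add, hb, hb', mul_add, Finset.sum_add_distrib]⟩
  obtain ⟨b, hb⟩ := hmem η
  refine ⟨b, ?_⟩
  rw [hb, Finset.sum_eq_single 1 (fun σ _ hσ => by rw [hψη σ hσ, mul_zero]) (by simp), hψ1,
    mul_comm]
  rfl

theorem Module.Basis.repr_eq_traceForm {K L ι : Type*} [Field K] [Field L] [Algebra K L]
    [FiniteDimensional K L] [Algebra.IsSeparable K L] [Finite ι] [DecidableEq ι]
    (b : Module.Basis ι K L) (x : L) (i : ι) :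
    b.repr x i = Algebra.trace K L (x * b.traceDual i) := by
  conv_lhs => rw [← b.traceDual_traceDual]
  rw [Module.Basis.traceDual_repr_apply, Algebra.traceForm_apply]

/-- Pairing with b_i turns both sides into Tr(b_i), the left one as the sum of the diagonal entries
of multiplication by b_i. -/
theorem Module.Basis.sum_mul_traceDual {K L ι : Type*} [Field K] [Field L] [Algebra K L]
    [FiniteDimensional K L] [Algebra.IsSeparable K L] [Fintype ι] [DecidableEq ι]
    (b : Module.Basis ι K L) : ∑ j, b j * b.traceDual j = 1 := by
  rw [Module.Basis.ext_elem_iff b.traceDual]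
  intro i
  rw [Module.Basis.traceDual_repr_apply, Module.Basis.traceDual_repr_apply,
    Algebra.traceForm_apply, Algebra.traceForm_apply, one_mul, Algebra.trace_eq_matrix_trace b (b i),
    Matrix.trace, Finset.sum_mul, map_sum]
  refine Finset.sum_congr rfl fun j _ => ?_
  rw [Matrix.diag_apply, Algebra.leftMulMatrix_eq_repr_mul, b.repr_eq_traceForm]
  congr 1
  ring

/-- For a basis e_j of B over A with trace dual e_j^∨, the elements n_j = m e_j^∨ lie in B and ∑ n_j
e_j = m. Writing x e_j = ∑ a_jl e_l, duality gives ∑_j n_j a_jl = n_l x. Expanding m dx = ∑ n_j (d(x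
e_j) - x de_j), the terms in de_l cancel and only the terms n_j e_l da_jl remain. -/
theorem smul_derivation_mem_of_mem_differentIdeal [Algebra.IsSeparable K L] [Module.Free A B]
    [Module.Finite A B] {R M : Type*} [CommRing R] [Algebra R L] [AddCommGroup M] [Module R M]
    [Module L M] [Module B M] [IsScalarTower B L M] (d : Derivation R L M) {m : B}
    (hm : m ∈ differentIdeal A B) (x : B) :
    m • d (algebraMap B L x) ∈ Submodule.span B (Set.range fun a : A => d (algebraMap A L a)) := by
  classical
  have hinj := IsFractionRing.injective B L
  have := IsIntegralClosure.isLocalization A K L B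
  let e := Module.Free.chooseBasis A B
  let b := e.localizationLocalization K (nonZeroDivisors A) L
  have hb : ∀ i, b i = algebraMap B L (e i) := fun i => e.localizationLocalization_apply ..
  have hrepr : ∀ y i, b.repr (algebraMap B L y) i = algebraMap A K (e.repr y i) :=
    fun y i => e.localizationLocalization_repr_algebraMap ..
  have hdual : ∀ j, ∃ n : B, algebraMap B L n = algebraMap B L m * b.traceDual j := by
    intro j
    refine (mem_differentIdeal_iff K L).1 hm _ fun y => ?_
    rw [mul_comm, ← b.repr_eq_traceForm]
    exact ⟨e.repr y j, (hrepr y j).symm⟩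
  choose n hn using hdual
  have h1 : ∑ j, n j * e j = m := by
    apply hinj
    rw [map_sum, ← mul_one (algebraMap B L m), ← b.sum_mul_traceDual, Finset.mul_sum]
    exact Finset.sum_congr rfl fun j _ => by rw [map_mul, hn, hb]; ring
  let a := fun j l => e.repr (x * e j) l
  have h2 : ∀ j, ∑ l, algebraMap A B (a j l) * e l = x * e j := by
    intro j
    conv_rhs => rw [← e.sum_repr (x * e j)]
    exact Finset.sum_congr rfl fun l _ => (Algebra.smul_def _ _).symm
  have h3 : ∀ l, ∑ j, n j * algebraMap A B (a j l) = n l * x := by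
    intro l
    apply hinj
    have h : ∑ j, algebraMap B L (algebraMap A B (a j l)) * b.traceDual j =
        algebraMap B L x * b.traceDual l := by
      conv_rhs => rw [← b.traceDual.sum_repr (algebraMap B L x * b.traceDual l)]
      refine Finset.sum_congr rfl fun j _ => ?_
      rw [Module.Basis.traceDual_repr_apply, Algebra.traceForm_apply, mul_right_comm,
        ← b.repr_eq_traceForm, hb, ← map_mul, Algebra.smul_def,
        hrepr, ← IsScalarTower.algebraMap_apply,
        ← IsScalarTower.algebraMap_apply]
    rw [map_mul, hn, mul_assoc, mul_comm (b.traceDual l), ← h, map_sum,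
      Finset.mul_sum]
    exact Finset.sum_congr rfl fun j _ => by rw [map_mul, hn]; ring
  have hsmul : ∀ (y : B) (z : M), algebraMap B L y • z = y • z := fun y z => algebraMap_smul L y z
  have hmul : ∀ y z : B, d (algebraMap B L (y * z)) =
      y • d (algebraMap B L z) + z • d (algebraMap B L y) := by
    intro y z
    rw [map_mul, Derivation.leibniz, hsmul, hsmul]
  have h4 : m • d (algebraMap B L x) =
      ∑ j, ∑ l, (n j * e l) • d (algebraMap B L (algebraMap A B (a j l))) := by
    have h5 : ∀ j, (n j * e j) • d (algebraMap B L x) =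
        ∑ l, (n j * algebraMap A B (a j l)) • d (algebraMap B L (e l)) +
        ∑ l, (n j * e l) • d (algebraMap B L (algebraMap A B (a j l))) -
        (n j * x) • d (algebraMap B L (e j)) := by
      intro j
      have := hmul x (e j)
      rw [← h2 j, map_sum, map_sum] at this
      simp only [hmul] at this
      rw [eq_sub_iff_add_eq, mul_smul, mul_smul, ← smul_add, add_comm (e j • _), ← this,
        Finset.sum_add_distrib, smul_add, Finset.smul_sum, Finset.smul_sum]
      simp only [mul_smul]
    rw [← h1, Finset.sum_smul]
    simp only [h5]
    rw [Finset.sum_sub_distrib, Finset.sum_add_distrib, Finset.sum_comm]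
    simp only [← Finset.sum_smul, h3]
    abel
  rw [h4]
  refine Submodule.sum_mem _ fun j _ => Submodule.sum_mem _ fun l _ =>
    Submodule.smul_mem _ _ (Submodule.subset_span ⟨a j l, ?_⟩)
  rw [← IsScalarTower.algebraMap_apply]

end Different

/-! ### Pullback of differentials along a separable extension -/

section Pullback

open scoped TensorProduct

variable {k F E : Type*} [Field k] [Field F] [Field E] [Algebra k F] [Algebra k E]
  [Algebra F E] [IsScalarTower k F E]

/-- Separability gives Ω_{E/F} = 0, so E ⊗ Ω_{F/k} surjects onto Ω_{E/k}. -/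
theorem exists_eq_smul_D_algebraMap [Algebra.IsSeparable F E] {f : F}
    (hf : ∀ ω : Ω[F⁄k], ∃ g : F, ω = g • KaehlerDifferential.D k F f) (ω : Ω[E⁄k]) :
    ∃ g : E, ω = g • KaehlerDifferential.D k E (algebraMap F E f) := by
  have hsub : Subsingleton Ω[E⁄F] :=
    (Algebra.FormallyUnramified.of_isSeparable F E).subsingleton_kaehlerDifferential
  have hω : ω ∈ LinearMap.range (KaehlerDifferential.mapBaseChange k F E) := by
    rw [KaehlerDifferential.range_mapBaseChange, LinearMap.mem_ker]
    exact Subsingleton.elim _ _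
  obtain ⟨z, rfl⟩ := hω
  induction z using TensorProduct.induction_on with
  | zero => exact ⟨0, by simp⟩
  | tmul b ω =>
    obtain ⟨g, rfl⟩ := hf ω
    refine ⟨b * algebraMap F E g, ?_⟩
    rw [KaehlerDifferential.mapBaseChange_tmul, map_smul, KaehlerDifferential.map_D, mul_smul,
      algebraMap_smul]
  | add y z hy hz =>
    obtain ⟨g, hg⟩ := hy
    obtain ⟨h, hh⟩ := hz
    exact ⟨g + h, by rw [map_add, hg, hh, add_smul]⟩

theorem D_algebraMap_ne_zero [Finite k] [FiniteDimensional F E] [Algebra.IsSeparable F E]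
    (hF : IsCurveFunctionField k F) {f : F} (hf : KaehlerDifferential.D k F f ≠ 0) :
    KaehlerDifferential.D k E (algebraMap F E f) ≠ 0 := by
  intro h0
  obtain ⟨x, hx⟩ := (hF.of_finite (E := E)).exists_D_ne_zero
  obtain ⟨g, hg⟩ := exists_eq_smul_D_algebraMap (E := E) (hF.exists_eq_smul_D hf)
    (KaehlerDifferential.D k E x)
  rw [h0, smul_zero] at hg
  exact hx hg

end Pullback

/-! ### The different exponent as the order of dt -/

namespace Place

open IsDedekindDomain

variable {k F E : Type*} [Field k] [Finite k] [Field F] [Field E] [Algebra k F] [Algebra k E]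
  [Algebra F E] [IsScalarTower k F E] [FiniteDimensional F E] [IsGalois F E]

theorem exists_differentIdeal_eq_span (hF : IsCurveFunctionField k F) (P : Place k F) {t : F}
    (ht : P.val t = WithZero.exp (-1)) {s : P.intClosure E}
    (hs : ∀ w : HeightOneSpectrum (P.intClosure E), w.valuation E (s : E) = WithZero.exp (-1)) :
    ∃ u : P.intClosure E, u ≠ 0 ∧
      KaehlerDifferential.D k E (algebraMap F E t) = (u : E) • KaehlerDifferential.D k E (s : E) ∧
      differentIdeal P.ring (P.intClosure E) = Ideal.span {u} := by
  obtain ⟨p, hp, _, _, _⟩ := exists_prime_charP k F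
  have hE : IsCurveFunctionField k E := hF.of_finite
  have hcE : CharP E p := charP_of_injective_algebraMap (algebraMap F E).injective p
  have hcB : CharP (P.intClosure E) p :=
    (algebraMap (P.intClosure E) E).charP (IsFractionRing.injective _ E) p
  obtain ⟨w₀⟩ := P.nonempty_heightOneSpectrum E
  -- As s is a uniformizer at every prime, the coefficients are integral at every prime, hence lie
  -- in the integral closure.
  have hspan : ∀ b : P.intClosure E, ∃ c : ℕ → P.intClosure E,
      b = ∑ i ∈ Finset.range p, c i ^ p * s ^ i := by
    intro b
    obtain ⟨c, hc⟩ := hE.exists_eq_sum_pow p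
      ((w₀.valuation E).pow_ne_of_uniformizer (hs w₀) hp.out) (b : E)
    have hcB : ∀ i, ∃ d : P.intClosure E, i ∈ Finset.range p → (d : E) = c i := by
      intro i
      by_cases hi : i ∈ Finset.range p
      · obtain ⟨d, hd⟩ := P.mem_intClosure_of_valuation_le_one (x := c i) fun w =>
          (w.valuation E).le_one_of_sum_pow_le_one (hs w) p c (hc ▸ w.valuation_le_one b) hi
        exact ⟨d, fun _ => hd⟩
      · exact ⟨0, fun h => absurd h hi⟩
    choose d hd using hcB
    refine ⟨d, Subtype.ext ?_⟩
    rw [hc]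
    push_cast
    exact Finset.sum_congr rfl fun i hi => by rw [hd i hi]
  have ht1 : t ∈ P.ring := by
    rw [P.mem_ring_iff]
    exact (WithZero.lt_one_iff_le_exp_neg_one.2 ht.le).le
  obtain ⟨c, hc⟩ := hspan (algebraMap P.ring _ ⟨t, ht1⟩)
  set u : P.intClosure E := ∑ i ∈ Finset.range p, (i : P.intClosure E) * c i ^ p * s ^ (i - 1)
    with hu
  have hDt : KaehlerDifferential.D k E (algebraMap F E t) =
      (u : E) • KaehlerDifferential.D k E (s : E) := by
    have h1 : algebraMap F E t = ∑ i ∈ Finset.range p, (c i : E) ^ p * (s : E) ^ i := by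
      have := congrArg (fun b : P.intClosure E => (b : E)) hc
      push_cast at this
      exact this
    rw [h1, Derivation.sum_pow_char p, hu]
    push_cast
    rfl
  have hDt0 : KaehlerDifferential.D k E (algebraMap F E t) ≠ 0 :=
    D_algebraMap_ne_zero hF (P.D_uniformizer_ne_zero hF ht)
  have hDs0 : KaehlerDifferential.D k E (s : E) ≠ 0 := by
    intro h0
    rw [h0, smul_zero] at hDt
    exact hDt0 hDt
  refine ⟨u, ?_, hDt, le_antisymm (fun m hm => ?_) ?_⟩
  · intro h0
    rw [h0, ZeroMemClass.coe_zero, zero_smul] at hDt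
    exact hDt0 hDt
  · have h1 := smul_derivation_mem_of_mem_differentIdeal (K := F) (L := E)
      (KaehlerDifferential.D k E) hm s
    -- Differentials of elements of 𝒪_P are 𝒪_P-multiples of dt = u ds.
    have h2 : ∀ z ∈ Submodule.span (P.intClosure E) (Set.range fun a : P.ring =>
        KaehlerDifferential.D k E (algebraMap P.ring E a)), ∃ b : P.intClosure E,
        z = ((b * u : P.intClosure E) : E) • KaehlerDifferential.D k E (s : E) := by
      intro z hz
      induction hz using Submodule.span_induction with
      | mem z hz =>
        obtain ⟨a, rfl⟩ := hz
        obtain ⟨g, hg, hga⟩ := P.exists_D_eq_smul hF ht (P.mem_ring_iff.1 a.2)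
        have h3 := congrArg (diffPullback (IsScalarTower.toAlgHom k F E)) hga
        have h4 := diffPullback_smul_D (IsScalarTower.toAlgHom k F E) 1 (a : F)
        rw [one_smul, map_one, one_smul] at h4
        rw [h4, diffPullback_smul_D] at h3
        refine ⟨algebraMap P.ring _ ⟨g, P.mem_ring_iff.2 hg⟩, h3.trans ?_⟩
        change algebraMap F E g • KaehlerDifferential.D k E (algebraMap F E t) = _
        rw [hDt, smul_smul]
        rfl
      | zero => exact ⟨0, by simp⟩
      | add x y _ _ hx hy =>
        obtain ⟨b, rfl⟩ := hx
        obtain ⟨b', rfl⟩ := hy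
        exact ⟨b + b', by rw [← add_smul, add_mul]; rfl⟩
      | smul b x _ hx =>
        obtain ⟨b', rfl⟩ := hx
        exact ⟨b * b', by
          rw [mul_assoc]
          exact smul_smul (b : E) ((b' * u : P.intClosure E) : E) (KaehlerDifferential.D k E (s : E))⟩
    obtain ⟨b, hb⟩ := h2 _ h1
    refine Ideal.mem_span_singleton'.2 ⟨b, ?_⟩
    exact (Subtype.ext (smul_left_injective E hDs0 hb)).symm
  · rw [Ideal.span_singleton_le_iff_mem]
    have hgen : ∀ ω : Ω[P.intClosure E⁄P.ring], ∃ g : P.intClosure E,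
        ω = g • KaehlerDifferential.D P.ring (P.intClosure E) s := by
      refine KaehlerDifferential.exists_eq_smul_D_of_forall fun b => ?_
      obtain ⟨d, rfl⟩ := hspan b
      exact ⟨_, Derivation.sum_pow_char p _ d s⟩
    -- Here u ds is the differential of t, a constant over 𝒪_P.
    have hu0 : u • KaehlerDifferential.D P.ring (P.intClosure E) s = 0 := by
      rw [hu, ← Derivation.sum_pow_char p, ← hc, Derivation.map_algebraMap]
    obtain ⟨η, hη, hη0⟩ := KaehlerDifferential.exists_annihilator_ideal hgen hu0
    rw [← hη]
    exact mem_differentIdeal_of_annihilator F E hη0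

/-- The different exponent is the order of the pullback of a generator of the differentials. -/
theorem exists_D_algebraMap_eq_smul (hF : IsCurveFunctionField k F) (P : Place k F) {t : F}
    (ht : P.val t = WithZero.exp (-1)) : ∃ s u : E,
    KaehlerDifferential.D k E (algebraMap F E t) = u • KaehlerDifferential.D k E s ∧
    ∀ (Q : Place k E) (h : Q.LiesAbove P), Q.val s = WithZero.exp (-1) ∧
      Q.val u = WithZero.exp (-(h.diffExp : ℤ)) := by
  obtain ⟨s, hs⟩ := P.exists_simultaneous_uniformizer E
  obtain ⟨u, hu0, hu, hd⟩ := P.exists_differentIdeal_eq_span hF ht hs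
  refine ⟨s, u, hu, fun Q h => ⟨?_, h.val_eq_exp_diffExp hu0 hd⟩⟩
  obtain ⟨w, -, hw⟩ := h.exists_prime
  rw [← hw, hs]

end Place

/-! ### Conjugate places and the local criterion -/

namespace Place

open IsDedekindDomain

section Conjugate

variable {k F E : Type*} [Field k] [Field F] [Field E] [Algebra k F] [Algebra k E]
  [Algebra F E] [FiniteDimensional F E] [IsGalois F E] {P : Place k F} {Q Q' : Place k E}

/-- The Galois group permutes the primes over P transitively, and a discrete valuation ring has no
overrings besides itself and the field. -/
theorem LiesAbove.exists_algEquiv (h : Q.LiesAbove P) (h' : Q'.LiesAbove P) :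
    ∃ σ : E ≃ₐ[F] E, ∀ x, Q'.val x = Q.val (σ x) := by
  have hcomm : SMulCommClass (E ≃ₐ[F] E) P.ring E :=
    ⟨fun σ a x => map_smul σ (a : F) x⟩
  have hG : IsGaloisGroup (E ≃ₐ[F] E) P.ring (P.intClosure E) :=
    IsGaloisGroup.of_isFractionRing _ _ _ F E
  obtain ⟨w, hw, hv⟩ := h.exists_prime
  obtain ⟨w', hw', hv'⟩ := h'.exists_prime
  have := w.isMaximal
  have := w'.isMaximal
  have := P.liesOver_maximalIdeal w.asIdeal
  have := P.liesOver_maximalIdeal w'.asIdeal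
  obtain ⟨σ, hσ⟩ := Ideal.exists_smul_eq_of_isGaloisGroup
    (IsDiscreteValuationRing.maximalIdeal P.ring).asIdeal w'.asIdeal w.asIdeal (E ≃ₐ[F] E)
  refine ⟨σ, fun x => ?_⟩
  obtain ⟨t, ht⟩ := Q.exists_uniformizer
  have hle : Q'.ring ≤ (Q.val.comap (σ : E →+* E)).valuationSubring := by
    intro x hx
    rw [Q'.mem_ring_iff, ← hv'] at hx
    obtain ⟨n, d, hnd⟩ := w'.exists_primeCompl_mul_eq_of_integer x hx
    have hd : Q.val (σ ((d : P.intClosure E) : E)) = 1 := by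
      rw [← hv]
      refine (w.valuation_eq_one_iff_notMem (r := σ • (d : P.intClosure E))).2 fun hmem => d.2 ?_
      rwa [← hσ, Ideal.smul_mem_pointwise_smul_iff] at hmem
    have hn : Q.val (σ (n : E)) ≤ 1 := by
      rw [← hv]
      exact w.valuation_le_one (σ • n)
    have h1 : σ x * σ ((d : P.intClosure E) : E) = σ (n : E) := by
      rw [← map_mul]
      exact congrArg σ hnd
    rwa [← h1, map_mul, hd, mul_one] at hn
  have heq := ValuationSubring.eq_of_le_of_ne_top _ hle fun htop => Q.ring_ne_top <| by
    rw [eq_top_iff]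
    intro y _
    have : σ.symm y ∈ (Q.val.comap (σ : E →+* E)).valuationSubring :=
      htop ▸ ValuationSubring.mem_top _
    rw [Q.mem_ring_iff]
    simpa [Valuation.mem_valuationSubring_iff] using this
  exact (congrArg (fun v => v x) (Q'.val_eq_of_valuationSubring_eq (Q.val.comap (σ : E →+* E))
    heq.symm (t := σ.symm t) (by simpa using ht))).symm

theorem LiesAbove.ramIdx_eq (h : Q.LiesAbove P) (h' : Q'.LiesAbove P) :
    h.ramIdx = h'.ramIdx := by
  obtain ⟨σ, hσ⟩ := h.exists_algEquiv h'
  obtain ⟨t, ht⟩ := P.exists_uniformizer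
  have h1 := hσ (algebraMap F E t)
  rw [σ.commutes, h.val_algebraMap, h'.val_algebraMap, ht, ← WithZero.exp_nsmul,
    ← WithZero.exp_nsmul, WithZero.exp_inj] at h1
  simp only [nsmul_eq_mul, mul_neg, mul_one] at h1
  omega

theorem LiesAbove.ramIdx_eq_ramIdxIn (h : Q.LiesAbove P) : h.ramIdx = P.ramIdxIn E := by
  have hex : ∃ Q : Place k E, Q.LiesAbove P := ⟨Q, h⟩
  rw [Place.ramIdxIn, dif_pos hex]
  exact h.ramIdx_eq hex.choose_spec

end Conjugate

variable {k F E : Type*} [Field k] [Finite k] [Field F] [Field E] [Algebra k F] [Algebra k E]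
  [Algebra F E] [IsScalarTower k F E] [FiniteDimensional F E] [IsGalois F E]
  {P : Place k F} {Q Q' : Place k E}

theorem exists_D_uniformizer_eq_smul {k F : Type*} [Field k] [Finite k] [Field F] [Algebra k F]
    (hF : IsCurveFunctionField k F) (P : Place k F) {s t : F} (hs : P.val s = WithZero.exp (-1))
    (ht : P.val t = WithZero.exp (-1)) :
    ∃ g : F, P.val g = 1 ∧ KaehlerDifferential.D k F s = g • KaehlerDifferential.D k F t := by
  obtain ⟨g, hg, hgs⟩ := P.exists_D_eq_smul hF ht (a := s)
    (WithZero.lt_one_iff_le_exp_neg_one.2 hs.le).le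
  obtain ⟨g', hg', hgt⟩ := P.exists_D_eq_smul hF hs (a := t)
    (WithZero.lt_one_iff_le_exp_neg_one.2 ht.le).le
  refine ⟨g, le_antisymm hg ?_, hgs⟩
  have h1 : g' * g = 1 := by
    apply smul_left_injective F (P.D_uniformizer_ne_zero hF ht)
    simp only [mul_smul, ← hgs, ← hgt, one_smul]
  rw [← map_one P.val, ← h1, map_mul]
  exact mul_le_of_le_one_left' hg'

/-- Applying σ to dt = u ds gives dt = σ(u) d(σs). Both s and σs are uniformizers at Q, so u and
σ(u) have the same order at Q; the order of σ(u) at Q is that of u at Q'. -/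
theorem LiesAbove.diffExp_eq (hF : IsCurveFunctionField k F) (h : Q.LiesAbove P)
    (h' : Q'.LiesAbove P) : h.diffExp = h'.diffExp := by
  obtain ⟨σ, hσ⟩ := h.exists_algEquiv h'
  obtain ⟨t, ht⟩ := P.exists_uniformizer
  obtain ⟨s, u, hu, hval⟩ := P.exists_D_algebraMap_eq_smul (E := E) hF ht
  have hE : IsCurveFunctionField k E := hF.of_finite
  have hs := (hval Q h).1
  obtain ⟨g, hg, hgs⟩ := exists_D_uniformizer_eq_smul hE Q (s := σ s) (t := s)
    (by rw [← hσ, (hval Q' h').1]) hs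
  have h1 := congrArg (diffPullback (σ.toAlgHom.restrictScalars k)) hu
  have h2 := diffPullback_smul_D (σ.toAlgHom.restrictScalars k) 1 (algebraMap F E t)
  rw [one_smul, map_one, one_smul] at h2
  rw [h2, diffPullback_smul_D] at h1
  have h3 : KaehlerDifferential.D k E (algebraMap F E t) =
      σ u • KaehlerDifferential.D k E (σ s) := by
    rw [← σ.commutes t]
    exact h1
  rw [hu, hgs, smul_smul] at h3
  have h4 := congrArg Q.val (smul_left_injective E (Q.D_uniformizer_ne_zero hE hs) h3)
  rw [map_mul, hg, mul_one, ← hσ, (hval Q h).2, (hval Q' h').2, WithZero.exp_inj] at h4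
  omega

theorem LiesAbove.diffExp_eq_diffExpIn (hF : IsCurveFunctionField k F) (h : Q.LiesAbove P) :
    h.diffExp = P.diffExpIn E := by
  have hex : ∃ Q : Place k E, Q.LiesAbove P := ⟨Q, h⟩
  rw [Place.diffExpIn, dif_pos hex]
  exact h.diffExp_eq hF hex.choose_spec

/-- The order of g u ds at Q is e·ord_P(g) + δ; as ord_P(g) is an integer, nonnegativity means
-ord_P(g) ≤ ⌊δ/e⌋. -/
theorem LiesAbove.diffPullback_mem_diffLattice_iff (hF : IsCurveFunctionField k F)
    (h : Q.LiesAbove P) (ω : Ω[F⁄k]) :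
    diffPullback (IsScalarTower.toAlgHom k F E) ω ∈ Q.diffLattice 0 ↔
      ω ∈ P.diffLattice (-floorDifferent k F E P) := by
  have hE : IsCurveFunctionField k E := hF.of_finite
  obtain ⟨t, ht⟩ := P.exists_uniformizer
  obtain ⟨g, rfl⟩ := hF.exists_eq_smul_D (P.D_uniformizer_ne_zero hF ht) ω
  obtain ⟨s, u, hu, hval⟩ := P.exists_D_algebraMap_eq_smul (E := E) hF ht
  have h1 : diffPullback (IsScalarTower.toAlgHom k F E) (g • KaehlerDifferential.D k F t) =
      (algebraMap F E g * u) • KaehlerDifferential.D k E s := by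
    rw [diffPullback_smul_D, mul_smul, ← hu]
    rfl
  rw [h1, Q.smul_D_mem_diffLattice_iff hE (hval Q h).1, P.smul_D_mem_diffLattice_iff hF ht,
    map_mul, h.val_algebraMap, (hval Q h).2, neg_neg, floorDifferent, ← h.diffExp_eq_diffExpIn hF,
    ← h.ramIdx_eq_ramIdxIn]
  have he := h.ramIdx_pos
  by_cases hg : P.val g = 0
  · simp [hg, he.ne']
  rw [← WithZero.log_le_iff_le_exp hg, Int.le_floor, le_div_iff₀ (by exact_mod_cast he),
    ← WithZero.log_le_iff_le_exp (by simp [hg]), WithZero.log_mul (by simp [hg]) (by simp),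
    WithZero.log_pow, WithZero.log_exp, nsmul_eq_mul]
  have : ((WithZero.log (P.val g) : ℤ) : ℚ) * (h.ramIdx : ℚ) ≤ (h.diffExp : ℚ) ↔
      WithZero.log (P.val g) * (h.ramIdx : ℤ) ≤ (h.diffExp : ℤ) := by exact_mod_cast Iff.rfl
  rw [this, mul_comm]
  omega

end Place

/-! ### Invariant differentials and the global isomorphisms -/

section Main

variable {k F E : Type*} [Field k] [Finite k] [Field F] [Field E]
    [Algebra k F] [Algebra k E] [Algebra F E] [IsScalarTower k F E]
    [FiniteDimensional F E] [IsGalois F E]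

theorem diffPullback_mem_holDiff_iff (hF : IsCurveFunctionField k F) (ω : Ω[F⁄k]) :
    diffPullback (IsScalarTower.toAlgHom k F E) ω ∈ holDiff k E ↔
      ω ∈ diffSpace (floorDifferent k F E) := by
  rw [holDiff, diffSpace, diffSpace, Submodule.mem_iInf, Submodule.mem_iInf]
  constructor
  -- The local criterion covers all places: every P has some Q above it, and every Q lies above some
  -- P.
  · intro h P
    obtain ⟨Q, hQ⟩ := P.exists_liesAbove E
    exact (hQ.diffPullback_mem_diffLattice_iff hF ω).1 (h Q)
  · intro h Q
    obtain ⟨P, hQ⟩ := Q.exists_center (F := F)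
    exact (hQ.diffPullback_mem_diffLattice_iff hF ω).2 (h P)

theorem diffPullback_injective (hF : IsCurveFunctionField k F) :
    Function.Injective (diffPullback (IsScalarTower.toAlgHom k F E)) := by
  rw [injective_iff_map_eq_zero]
  intro ω hω
  obtain ⟨f, hf⟩ := hF.exists_D_ne_zero
  obtain ⟨g, rfl⟩ := hF.exists_eq_smul_D hf ω
  rw [diffPullback_smul_D, smul_eq_zero] at hω
  have hg : g = 0 := (algebraMap F E).injective (by
    rw [map_zero]
    exact hω.resolve_right (D_algebraMap_ne_zero hF hf))
  rw [hg, zero_smul]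

omit [Finite k] [FiniteDimensional F E] [IsGalois F E] in
theorem diffPullback_comp_algEquiv (σ : E ≃ₐ[F] E) (a : E) (f : F) :
    diffPullback (σ.toAlgHom.restrictScalars k)
      (a • KaehlerDifferential.D k E (algebraMap F E f)) =
      σ a • KaehlerDifferential.D k E (algebraMap F E f) := by
  rw [diffPullback_smul_D]
  conv_rhs => rw [← σ.commutes f]
  rfl

/-- With f in F, df is a Galois-invariant basis of Ω_{E/k} over E, so invariance of a df is
invariance of a. -/
theorem mem_range_diffPullback_iff (hF : IsCurveFunctionField k F) (ω : Ω[E⁄k]) :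
    (∃ η, diffPullback (IsScalarTower.toAlgHom k F E) η = ω) ↔
      ∀ σ : E ≃ₐ[F] E, diffPullback (σ.toAlgHom.restrictScalars k) ω = ω := by
  obtain ⟨f, hf⟩ := hF.exists_D_ne_zero
  have hf' := D_algebraMap_ne_zero (E := E) hF hf
  constructor
  · rintro ⟨η, rfl⟩ σ
    obtain ⟨g, rfl⟩ := hF.exists_eq_smul_D hf η
    rw [diffPullback_smul_D]
    refine (diffPullback_comp_algEquiv σ _ f).trans ?_
    rw [IsScalarTower.coe_toAlgHom', σ.commutes]
  · intro h
    obtain ⟨a, rfl⟩ := exists_eq_smul_D_algebraMap (E := E) (hF.exists_eq_smul_D hf) ω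
    have ha : ∀ σ : E ≃ₐ[F] E, σ a = a := fun σ => by
      have := h σ
      rw [diffPullback_comp_algEquiv] at this
      exact smul_left_injective E hf' this
    obtain ⟨g, rfl⟩ := (IsGalois.mem_range_algebraMap_iff_fixed a).2 ha
    exact ⟨g • KaehlerDifferential.D k F f, diffPullback_smul_D _ _ _⟩

theorem diffPullback_mem_invHolDiff_iff (hF : IsCurveFunctionField k F) (ω : Ω[F⁄k]) :
    diffPullback (IsScalarTower.toAlgHom k F E) ω ∈ invHolDiff k F E ↔
      ω ∈ diffSpace (floorDifferent k F E) := by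
  rw [← diffPullback_mem_holDiff_iff (E := E) hF, invHolDiff, Submodule.mem_inf,
    Submodule.mem_iInf]
  exact and_iff_left ((mem_range_diffPullback_iff hF _).1 ⟨ω, rfl⟩)

/-- Pullback identifies `L(Ω(D))` with the invariant holomorphic differentials, for the divisor
`D = ∏ P ^ ⌊δ_P / e_P⌋`. -/
noncomputable def diffSpaceEquivInvHolDiff (hF : IsCurveFunctionField k F) :
    diffSpace (floorDifferent k F E) ≃ₗ[k] invHolDiff k F E :=
  LinearEquiv.ofBijective
    ((diffPullback (IsScalarTower.toAlgHom k F E)).restrict fun ω hω =>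
      (diffPullback_mem_invHolDiff_iff hF ω).2 hω) <| by
    constructor
    · intro x y hxy
      exact Subtype.ext (diffPullback_injective (E := E) hF (congrArg Subtype.val hxy))
    · rintro ⟨ω, hω⟩
      have h := hω.2
      rw [SetLike.mem_coe, Submodule.mem_iInf] at h
      obtain ⟨η, rfl⟩ := (mem_range_diffPullback_iff hF ω).2 h
      exact ⟨⟨η, (diffPullback_mem_invHolDiff_iff hF η).1 hω⟩, rfl⟩

/-- Multiplication with `df` identifies a Riemann-Roch space of functions with a space of
differentials. -/
noncomputable def rrSpaceEquivDiffSpace {k F : Type*} [Field k] [Finite k] [Field F] [Algebra k F]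
    (hF : IsCurveFunctionField k F) {f : F} (hf : KaehlerDifferential.D k F f ≠ 0)
    (D : Place k F → ℤ) :
    rrSpace (fun P : Place k F => P.ordDiff (KaehlerDifferential.D k F f) + D P) ≃ₗ[k]
      diffSpace D :=
  LinearEquiv.ofBijective
    (((LinearMap.toSpanSingleton F Ω[F⁄k] (KaehlerDifferential.D k F f)).restrictScalars
      k).restrict fun g hg => (smul_mem_diffSpace_iff hF hf D g).2 hg) <| by
    constructor
    · intro x y hxy
      exact Subtype.ext (smul_left_injective F hf (congrArg Subtype.val hxy))
    · rintro ⟨ω, hω⟩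
      obtain ⟨g, rfl⟩ := hF.exists_eq_smul_D hf ω
      exact ⟨⟨g, (smul_mem_diffSpace_iff hF hf D g).1 hω⟩, rfl⟩

end Main

theorem mainTheorem9 {k F E : Type*} [Field k] [Finite k] [Field F] [Field E]
    [Algebra k F] [Algebra k E] [Algebra F E] [IsScalarTower k F E]
    (hF : IsCurveFunctionField k F) [FiniteDimensional F E] [IsGalois F E] :
    -- the ramification index and the different exponent depend only on the place below
    (∀ (P : Place k F) (Q : Place k E) (h : Q.LiesAbove P),
      h.ramIdx = P.ramIdxIn E ∧ h.diffExp = P.diffExpIn E) ∧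
    -- pullback identifies the differentials on `Y` with the invariant differentials on `X`
    (∃ Φ : diffSpace (floorDifferent k F E) ≃ₗ[k] invHolDiff k F E,
      ∀ ω, (Φ ω : Ω[E⁄k]) = diffPullback (IsScalarTower.toAlgHom k F E) (ω : Ω[F⁄k])) ∧
    ∀ f : F, KaehlerDifferential.D k F f ≠ 0 →
      -- the description of the differentials on `Y` by functions, `g ↦ g df`
      (∃ Ψ : rrSpace (fun P : Place k F =>
            P.ordDiff (KaehlerDifferential.D k F f) + floorDifferent k F E P) ≃ₗ[k]
          diffSpace (floorDifferent k F E),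
        ∀ g, (Ψ g : Ω[F⁄k]) = (g : F) • KaehlerDifferential.D k F f) ∧
      -- the resulting description of the invariant differentials on `X`
      (∃ Θ : rrSpace (fun P : Place k F =>
            P.ordDiff (KaehlerDifferential.D k F f) + floorDifferent k F E P) ≃ₗ[k]
          invHolDiff k F E,
        ∀ g, (Θ g : Ω[E⁄k]) =
          algebraMap F E (g : F) • KaehlerDifferential.D k E (algebraMap F E f)) := by
  refine ⟨fun P Q h => ⟨h.ramIdx_eq_ramIdxIn, h.diffExp_eq_diffExpIn hF⟩,
    ⟨diffSpaceEquivInvHolDiff hF, fun ω => rfl⟩, fun f hf =>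
    ⟨⟨rrSpaceEquivDiffSpace hF hf _, fun g => rfl⟩,
      ⟨(rrSpaceEquivDiffSpace hF hf _).trans (diffSpaceEquivInvHolDiff hF), fun g => ?_⟩⟩⟩
  exact diffPullback_smul_D (IsScalarTower.toAlgHom k F E) (g : F) f
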